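/- Let $n\ge 2$, $k\ge 0$, and let $P_k^+=\{m\in\mathbb Z_{\ge0}^n:\sum_i m_i=k\}$, where $m=\hat\lambda$ is identified with the partition $\lambda=(\lambda_1,\dots,\lambda_{n-1})$, $\lambda_i=m_i+\dots+m_{n-1}$, $\lambda_1\le k$. Put $\lambda_n=0$, $|\lambda|=\sum_i\lambda_i$, let $\lambda^t$ be the transposed partition, and let $\hat\emptyset=(0,\dots,0,k)$. Let $\mathbb CP^+$ be the complex vector space with basis $\mathbb Z_{\ge 0}^n$, orthonormal for an inner product $\langle\cdot,\cdot\rangle$ that is antilinear in the first factor, and let $\mathbb CP^+_k$ be the span of $P_k^+$. On $\mathbb CP^+$ let $\varphi_i^*$ raise $m_i$ by one, let $\varphi_i$ lower $m_i$ by one (giving $0$ if $m_i=0$), and put $a_j=\varphi_{j+1}^*\varphi_j$ for $1\le j\le n-1$. For $z=1$ define, for $r\ge 0$ and a partition $\lambda$ as above, $$h_r(\mathcal A)=\sum_{\varepsilon_0+\dots+\varepsilon_{n-1}=r}(\varphi_1^*)^{\varepsilon_0}a_1^{\varepsilon_1}\cdots a_{n-1}^{\varepsilon_{n-1}}\varphi_n^{\varepsilon_0},\qquad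 s_\lambda(\mathcal A)=\det\big(h_{\lambda_i-i+j}(\mathcal A)\big)_{1\le i,j\le n-1},$$ with $h_r(\mathcal A)=0$ for $r<0$. The $h_r(\mathcal A)$ commute with each other on $\mathbb CP_k^+$, so that the determinant is unambiguous there. Let $A(u)=(1+ua_{n-1})\cdots(1+ua_1)$, $B(u)=uA(u)\varphi_1^*$ and $T(u)=A(u)+u\varphi_nA(u)\varphi_1^*$. For $\hat\sigma\in P_k^+$ let $\zeta=e^{2\pi i/(k+n)}$, let $$x_i^\sigma=\zeta^{\frac{|\sigma|}{n}+\frac{k+1}{2}+\sigma^t_{k+1-i}-(k+1-i)}\quad(1\le i\le k),\qquad b_\sigma=B(1/x_1^\sigma)\cdots B(1/x_k^\sigma)\,(0,\dots,0),\qquad \hat b_\sigma=\frac{b_\sigma}{\langle b_\sigma,b_\sigma\rangle}.$$ Let $\rho$ be the Weyl vector of $su(n)$, and let $$S_{\hat\lambda\hat\sigma}=\frac{e^{i\pi n(n-1)/4}}{\sqrt{n(k+n)^{n-1}}}\sum_{w\in\mathbb S_n}(-1)^{\ell(w)}e^{-\frac{2\pi i}{k+n}(\sigma+\rho,\,w(\lambda+\rho))},\qquad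 \mathcal N_{\hat\lambda\hat\mu}^{\hat\nu}=\sum_{\hat\sigma\in P_k^+}\frac{S_{\hat\lambda\hat\sigma}S_{\hat\mu\hat\sigma}(S^{-1})_{\hat\nu\hat\sigma}}{S_{\hat\emptyset\hat\sigma}}.$$ Then the following hold. 1. For $\hat\lambda,\hat\mu\in P_k^+$ the vector $\hat\lambda*\hat\mu:=s_\lambda(\mathcal A)\hat\mu$ lies in $\mathbb CP_k^+$, and the bilinear extension of $*$ makes $\mathbb CP_k^+$ an associative and commutative algebra with unit $\hat\emptyset$. 2. The numbers $\mathcal N_{\hat\lambda\hat\mu}^{\hat\nu}$ are integers and are the structure constants of a commutative, associative ring $\mathcal F_{n,k}$ with $\mathbb Z$-basis $P_k^+$ and unit $\hat\emptyset$ (the fusion ring). The map $\hat\lambda\mapsto 1\otimes\hat\lambda$ is an isomorphism of $\mathbb C$-algebras from $(\mathbb CP_k^+,*)$ to the Verlinde algebra $\mathbb C\otimes_{\mathbb Z}\mathcal F_{n,k}$. 3. The normalised Bethe vectors are orthogonal idempotents: $\hat b_\sigma*\hat b_\tau=\delta_{\sigma,\tau}\,\hat b_\sigma$ for all $\hat\sigma,\hat\tau\in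 P_k^+$. 4. The Bethe ansatz is complete, that is, the vectors $b_\sigma$, $\hat\sigma\in P_k^+$, form a basis of $\mathbb CP_k^+$ that consists of eigenvectors of all $h_r(\mathcal A)$, $r\ge0$, and of all $T(u)$, $u\in\mathbb C$; and this completeness is equivalent to the semisimplicity of the Verlinde algebra (so that both hold). -/

import Mathlib

open scoped TensorProduct

namespace PhaseModel

noncomputable section

/-! ## State space and the phase algebra

Throughout `n = N + 1`, and the node `i ∈ {1, …, n}` of the affine Dynkin diagram is the
element `i - 1` of `Fin (N + 1)`; the affine node `n` is `Fin.last N`. -/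

/-- The state space `ℂP⁺ = 𝓜^{⊗ n}`, with basis the `n`-tuples of Dynkin labels. -/
abbrev State (N : ℕ) : Type := (Fin (N + 1) → ℕ) →₀ ℂ

/-- The basis vector of an `n`-tuple of Dynkin labels. -/
def ket {N : ℕ} (m : Fin (N + 1) → ℕ) : State N := Finsupp.single m 1

/-- The inner product for which the `ket m` are orthonormal, antilinear in the first factor. -/
def inn {N : ℕ} (f g : State N) : ℂ := f.sum fun m c => (starRingEnd ℂ) c * g m

/-- The creation operator `φᵢ*`. -/
def create {N : ℕ} (i : Fin (N + 1)) : Module.End ℂ (State N) :=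
  Finsupp.linearCombination ℂ fun m => ket (m + Pi.single i 1)

/-- The annihilation operator `φᵢ`. -/
def annih {N : ℕ} (i : Fin (N + 1)) : Module.End ℂ (State N) :=
  Finsupp.linearCombination ℂ fun m => if 0 < m i then ket (m - Pi.single i 1) else 0

/-- The plactic generator `a_j = φ_{j+1}* φ_j`, `1 ≤ j ≤ n - 1` (here `j` is counted from `0`). -/
def plac {N : ℕ} (j : Fin N) : Module.End ℂ (State N) := create j.succ * annih j.castSucc

/-- The affine plactic complete symmetric polynomial
`h_r(𝓐) = ∑_{ε ⊢ r} z^{ε₀} (φ₁*)^{ε₀} a₁^{ε₁} ⋯ a_{n-1}^{ε_{n-1}} φ_n^{ε₀}`. -/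
def hOp {N : ℕ} (z : ℂ) (r : ℕ) : Module.End ℂ (State N) :=
  ∑ ε ∈ Finset.piAntidiag (Finset.univ : Finset (Fin (N + 1))) r,
    z ^ ε 0 • (create 0 ^ ε 0 * (List.ofFn fun j : Fin N => plac j ^ ε j.succ).prod *
      annih (Fin.last N) ^ ε 0)

/-- `h_d(𝓐)` for an integer `d`, equal to `0` for `d < 0`. -/
def hOpInt {N : ℕ} (z : ℂ) (d : ℤ) : Module.End ℂ (State N) :=
  if 0 ≤ d then hOp z d.toNat else 0

/-- The affine plactic Schur polynomial `det (h_{lᵢ - i + j}(𝓐))_{1 ≤ i, j ≤ n - 1}`, as the Leibniz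
expansion of the determinant (the entries commute with each other). -/
def schurOp {N : ℕ} (z : ℂ) (l : Fin N → ℕ) : Module.End ℂ (State N) :=
  ∑ w : Equiv.Perm (Fin N), (Equiv.Perm.sign w : ℤ) •
    (List.ofFn fun i : Fin N => hOpInt z ((l i : ℤ) - (i : ℤ) + (w i : ℤ))).prod

/-- `A(u) = (1 + u a_{n-1}) ⋯ (1 + u a₁)`. -/
def opA {N : ℕ} (u : ℂ) : Module.End ℂ (State N) :=
  (List.ofFn fun j : Fin N => 1 + u • plac j.rev).prod

/-- `B(u) = u A(u) φ₁*`. -/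
def opB {N : ℕ} (u : ℂ) : Module.End ℂ (State N) := u • (opA u * create 0)

/-- `D(u) = u φ_n A(u) φ₁*`. -/
def opD {N : ℕ} (u : ℂ) : Module.End ℂ (State N) :=
  u • (annih (Fin.last N) * opA u * create 0)

/-- The auxiliary matrix `T(u) = A(u) + z D(u)`. -/
def opT {N : ℕ} (z u : ℂ) : Module.End ℂ (State N) := opA u + z • opD u

/-! ## Dominant integral weights of level `k` -/

/-- `P_k⁺`: the `n`-tuples of Dynkin labels with sum `k`. -/
abbrev Weight (N k : ℕ) : Type := {m : Fin (N + 1) → ℕ // ∑ i, m i = k}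

instance (N k : ℕ) : Fintype (Weight N k) :=
  Fintype.subtype (Finset.piAntidiag Finset.univ k) (by simp)

/-- The weight `k ω_n` of the empty partition. -/
def vac (N k : ℕ) : Weight N k := ⟨Pi.single (Fin.last N) k, by simp⟩

/-- The `i`-th part of the partition of a weight: `λᵢ = mᵢ + ⋯ + m_{n-1}`, so that
`λᵢ - λᵢ₊₁ = mᵢ` for `i < n` and `λ_n = 0`. -/
def part {N : ℕ} (m : Fin (N + 1) → ℕ) (i : Fin (N + 1)) : ℕ :=
  ∑ j with i ≤ j ∧ j ≠ Fin.last N, m j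

/-- The number `|λ|` of boxes. -/
def size {N : ℕ} (m : Fin (N + 1) → ℕ) : ℕ := ∑ i, part m i

/-- The `j`-th part (`j ≥ 1`) of the transposed partition. -/
def transp {N : ℕ} (m : Fin (N + 1) → ℕ) (j : ℕ) : ℕ :=
  (Finset.univ.filter fun i => j ≤ part m i).card

/-- The partition `λ = (λ₁, …, λ_{n-1})` of a weight of level `k`. -/
def Weight.toPart {N k : ℕ} (l : Weight N k) (i : Fin N) : ℕ := part l.1 i.castSucc

/-- The subspace `ℂP_k⁺` of `ℂP⁺`. -/
def levelSpace (N k : ℕ) : Submodule ℂ (State N) :=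
  Finsupp.supported ℂ ℂ {m | ∑ i, m i = k}

/-- The vector of `ℂP_k⁺` with given coordinates. -/
def toState {N k : ℕ} (f : Weight N k → ℂ) : State N := ∑ m, f m • ket m.1

/-! ## Algebras given by structure constants -/

/-- The bilinear product on `ι → R` with `eᵢ eⱼ = ∑ₗ c i j l • eₗ`. -/
def strMul {R ι : Type} [CommRing R] [Fintype ι] (c : ι → ι → ι → R) (f g : ι → R) : ι → R :=
  fun l => ∑ i, ∑ j, f i * g j * c i j l

/-- The product with structure constants `c` is commutative and associative with unit `e`. -/
structure IsCommAlg {R ι : Type} [CommRing R] [Fintype ι] (c : ι → ι → ι → R) (e : ι → R) :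
    Prop where
  comm : ∀ f g, strMul c f g = strMul c g f
  assoc : ∀ f g h, strMul c (strMul c f g) h = strMul c f (strMul c g h)
  unit : ∀ f, strMul c e f = f

/-- The free module `ι → R` with the product of structure constants `c`. -/
def StrAlg {R ι : Type} [CommRing R] [Fintype ι] {c : ι → ι → ι → R} {e : ι → R}
    (_h : IsCommAlg c e) : Type := ι → R

section StrAlg

variable {R ι : Type} [CommRing R] [Fintype ι] {c : ι → ι → ι → R} {e : ι → R}

/-- The element with given coordinates. -/
def StrAlg.of (h : IsCommAlg c e) (f : ι → R) : StrAlg h := f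

instance (h : IsCommAlg c e) : AddCommGroup (StrAlg h) :=
  inferInstanceAs (AddCommGroup (ι → R))

theorem strMul_add (f g h : ι → R) : strMul c f (g + h) = strMul c f g + strMul c f h := by
  funext l
  simp only [strMul, Pi.add_apply, mul_add, add_mul, Finset.sum_add_distrib]

theorem add_strMul (f g h : ι → R) : strMul c (f + g) h = strMul c f h + strMul c g h := by
  funext l
  simp only [strMul, Pi.add_apply, add_mul, Finset.sum_add_distrib]

theorem zero_strMul (f : ι → R) : strMul c 0 f = 0 := by
  funext l
  simp [strMul]

theorem strMul_zero (f : ι → R) : strMul c f 0 = 0 := by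
  funext l
  simp [strMul]

theorem smul_strMul (r : R) (f g : ι → R) : strMul c (r • f) g = r • strMul c f g := by
  funext l
  simp only [strMul, Pi.smul_apply, smul_eq_mul, Finset.mul_sum]
  refine Finset.sum_congr rfl fun i _ => Finset.sum_congr rfl fun j _ => ?_
  ring

theorem strMul_smul (r : R) (f g : ι → R) : strMul c f (r • g) = r • strMul c f g := by
  funext l
  simp only [strMul, Pi.smul_apply, smul_eq_mul, Finset.mul_sum]
  refine Finset.sum_congr rfl fun i _ => Finset.sum_congr rfl fun j _ => ?_
  ring

instance (h : IsCommAlg c e) : CommRing (StrAlg h) :=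
  { (inferInstance : AddCommGroup (StrAlg h)) with
    mul := fun f g => strMul c f g
    one := e
    left_distrib := fun f g k => strMul_add f g k
    right_distrib := fun f g k => add_strMul f g k
    zero_mul := fun f => zero_strMul f
    mul_zero := fun f => strMul_zero f
    mul_assoc := h.assoc
    one_mul := h.unit
    mul_one := fun f => (h.comm f e).trans (h.unit f)
    mul_comm := h.comm }

end StrAlg

instance {ι : Type} [Fintype ι] {c : ι → ι → ι → ℂ} {e : ι → ℂ} (h : IsCommAlg c e) :
    Module ℂ (StrAlg h) :=
  inferInstanceAs (Module ℂ (ι → ℂ))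

instance {ι : Type} [Fintype ι] {c : ι → ι → ι → ℂ} {e : ι → ℂ} (h : IsCommAlg c e) :
    Algebra ℂ (StrAlg h) :=
  Algebra.ofModule
    (fun r f g => smul_strMul r f g)
    (fun r f g => strMul_smul r f g)

/-! ## The combinatorial product -/

/-- The structure constants of `λ̂ * μ̂ = s_λ(𝓐) μ̂` on `ℂP_k⁺`: the coefficient of `ν̂`. -/
def combConst (N k : ℕ) (z : ℂ) (l m v : Weight N k) : ℂ :=
  schurOp z l.toPart (ket m.1) v.1

/-! ## The modular `S`-matrix and the Verlinde formula -/

/-- The vector `λ + ρ` of the weight space of `su(n)`, realised in `ℝⁿ` as the hyperplane of vectors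
with coordinate sum zero. -/
def rhoShift {N : ℕ} (m : Fin (N + 1) → ℕ) (i : Fin (N + 1)) : ℝ :=
  ((part m i : ℝ) - (size m : ℝ) / (N + 1)) + ((N : ℝ) / 2 - (i : ℝ))

/-- The Kac-Peterson formula
`S_{λσ} = e^{iπn(n-1)/4} (n (k+n)^{n-1})^{-1/2} ∑_w (-1)^{ℓ(w)} e^{-2πi (σ+ρ, w(λ+ρ)) / (k+n)}`. -/
def modularS (N k : ℕ) : Matrix (Weight N k) (Weight N k) ℂ := fun l s =>
  Complex.exp (Complex.I * Real.pi * ((N + 1) * N) / 4) /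
      (Real.sqrt (((N : ℝ) + 1) * ((k : ℝ) + (N + 1)) ^ N) : ℂ) *
    ∑ w : Equiv.Perm (Fin (N + 1)), ((Equiv.Perm.sign w : ℤ) : ℂ) *
      Complex.exp (-(2 * Real.pi * Complex.I / ((k : ℂ) + (N + 1))) *
        ((∑ i, rhoShift s.1 i * rhoShift l.1 (w⁻¹ i) : ℝ) : ℂ))

/-- The fusion coefficient `N_{λμ}^{(k)ν}`, by the Verlinde formula. -/
def fusionCoeff (N k : ℕ) (l m v : Weight N k) : ℂ :=
  ∑ s, modularS N k l s * modularS N k m s * (modularS N k)⁻¹ v s / modularS N k (vac N k) s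

/-! ## Bethe vectors at `z = 1` -/

/-- The Bethe roots `x^σ = ζ^{|σ|/n} (ζ^{I₁}, …, ζ^{I_k})` with `ζ = exp(2πi/(k+n))` and
`I = ((k+1)/2 + σᵗ_k - k, …, (k+1)/2 + σᵗ_1 - 1)`. -/
def betheRoot {N k : ℕ} (s : Weight N k) (i : Fin k) : ℂ :=
  Complex.exp (2 * Real.pi * Complex.I / ((k : ℂ) + (N + 1)) *
    ((size s.1 : ℂ) / (N + 1) +
      (((k : ℂ) + 1) / 2 + (transp s.1 (k - i) : ℂ) - ((k : ℂ) - (i : ℂ)))))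

/-- The Bethe vector `b_σ = B(x₁⁻¹) ⋯ B(x_k⁻¹) Ω̂`, with `Ω̂` the tuple `(0, …, 0)`. -/
def betheVec {N k : ℕ} (s : Weight N k) : State N :=
  (List.ofFn fun i : Fin k => opB (betheRoot s i)⁻¹).prod (ket 0)

/-- The coordinates in `ℂP_k⁺` of the normalised Bethe vector `b_σ / ⟨b_σ, b_σ⟩`. -/
def betheHat {N k : ℕ} (s : Weight N k) : Weight N k → ℂ := fun m =>
  betheVec s m.1 / inn (betheVec s) (betheVec s)

/-- Completeness of the Bethe ansatz at `z = 1`: the Bethe vectors form a basis of `ℂP_k⁺` that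
consists of eigenvectors of the auxiliary matrix `T(u)` for all `u` and of the transfer matrix
`Q(u) = ∑_r u^r h_r(𝓐)`, that is, of all its coefficients `h_r(𝓐)`. -/
def BetheComplete (N k : ℕ) : Prop :=
  LinearIndependent ℂ (fun s : Weight N k => betheVec s) ∧
  Submodule.span ℂ (Set.range fun s : Weight N k => betheVec s) = levelSpace N k ∧
  ∀ s : Weight N k,
    (∀ r : ℕ, ∃ a : ℂ, hOp 1 r (betheVec s) = a • betheVec s) ∧
    (∀ u : ℂ, ∃ a : ℂ, opT 1 u (betheVec s) = a • betheVec s)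

end

end PhaseModel

namespace PhaseModel

noncomputable section

/-! The label `m` is encoded by the positions of `N + 1` particles on a line, and `φ₁*`, `a_j`,
`φ_n` move one particle by one site. If the momenta `y` have product `1` and a common `(k + n)`-th
power, the Slater determinant `det (y_j ^ l_i)` of the positions is a simultaneous eigenvector
("wave") of `T(u)` and of all `h_r(𝓐)`; its eigenvalues are `∏ (1 + u / y_j)` and the complete
symmetric functions `H_r(y⁻¹)`. By Jacobi–Trudi, `s_λ(𝓐)` then acts by the Schur function of
`y⁻¹`, which for the momenta `y = y(σ)` attached to `σ` is the quotient `S_{λσ} / S_{∅σ}`.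

Distinct waves are orthogonal: the adjoint of `h_r(𝓐)` is `h_{k - r}(𝓐)` up to the rotation
`h_k(𝓐)` of the labels, so waves that pair nontrivially with the same wave have the same
eigenvalues, and these determine `σ`. Hence `S` is invertible and evaluation at all `σ` turns both
products into the pointwise one on `ℂ ^ P_k⁺`. Integrality holds because `s_λ(𝓐)` preserves the
integral lattice. Finally, the inverse Bethe roots of `σ` are, up to sign, the `(k + n)`-th roots
complementary to `y(σ)`; elementary symmetric functions of the former are thus complete ones of
the latter, and `b_σ` is proportional to the wave of `σ`. -/

/-! ## Particle positions -/

theorem create_ket {N : ℕ} (i : Fin (N + 1)) (m : Fin (N + 1) → ℕ) :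
    create i (ket m) = ket (m + Pi.single i 1) := by
  simp [create, ket]

theorem annih_ket {N : ℕ} (i : Fin (N + 1)) (m : Fin (N + 1) → ℕ) :
    annih i (ket m) = if 0 < m i then ket (m - Pi.single i 1) else 0 := by
  simp [annih, ket]

theorem ket_apply {N : ℕ} (m m' : Fin (N + 1) → ℕ) : ket m m' = if m = m' then 1 else 0 := by
  simp [ket, Finsupp.single_apply]

theorem linearMap_ext_ket {N : ℕ} {V : Type*} [AddCommGroup V] [Module ℂ V]
    {f g : State N →ₗ[ℂ] V} (h : ∀ m, f (ket m) = g (ket m)) : f = g :=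
  Finsupp.lhom_ext' fun m => LinearMap.ext_ring (h m)

theorem single_le_iff {ι : Type*} [DecidableEq ι] {m : ι → ℕ} {i : ι} {e : ℕ} :
    Pi.single i e ≤ m ↔ e ≤ m i := by
  refine ⟨fun h => by simpa using h i, fun h j => ?_⟩
  obtain rfl | hj := eq_or_ne j i
  · simpa using h
  · simp [hj]

theorem create_apply {N : ℕ} (i : Fin (N + 1)) (f : State N) (m : Fin (N + 1) → ℕ) :
    create i f m = if 1 ≤ m i then f (m - Pi.single i 1) else 0 := by
  suffices Finsupp.lapply m ∘ₗ create i =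
      if 1 ≤ m i then Finsupp.lapply (m - Pi.single i 1) else 0 by
    have := LinearMap.congr_fun this f
    split_ifs at this ⊢ <;> exact this
  refine linearMap_ext_ket fun a => ?_
  rw [LinearMap.comp_apply, Finsupp.lapply_apply, create_ket, ket_apply]
  split_ifs with ha hm hm
  · subst ha
    simp [ket_apply]
  · subst ha
    simp at hm
  · rw [Finsupp.lapply_apply, ket_apply, if_neg]
    rintro rfl
    exact ha (tsub_add_cancel_of_le (single_le_iff.mpr hm))
  · rfl

theorem annih_apply {N : ℕ} (i : Fin (N + 1)) (f : State N) (m : Fin (N + 1) → ℕ) :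
    annih i f m = f (m + Pi.single i 1) := by
  suffices Finsupp.lapply m ∘ₗ annih i = Finsupp.lapply (m + Pi.single i 1) from
    LinearMap.congr_fun this f
  refine linearMap_ext_ket fun a => ?_
  rw [LinearMap.comp_apply, annih_ket, Finsupp.lapply_apply, Finsupp.lapply_apply, ket_apply]
  split_ifs with ha hm hm
  · subst hm
    simp [ket_apply]
  · rw [ket_apply, if_neg]
    rintro rfl
    exact hm (tsub_add_cancel_of_le (single_le_iff.mpr ha)).symm
  · subst hm
    simp at ha
  · rfl

theorem create_pow_apply {N : ℕ} (i : Fin (N + 1)) (e : ℕ) (f : State N)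
    (m : Fin (N + 1) → ℕ) :
    (create i ^ e) f m = if e ≤ m i then f (m - Pi.single i e) else 0 := by
  induction e generalizing m with
  | zero => simp
  | succ e ih =>
    rw [pow_succ', Module.End.mul_apply, create_apply, ih]
    have hle : e ≤ (m - Pi.single i 1 : Fin (N + 1) → ℕ) i ↔ e + 1 ≤ m i ∨ m i = 0 ∧ e = 0 := by
      simp only [Pi.sub_apply, Pi.single_eq_same]
      omega
    have hsub : m - Pi.single i 1 - Pi.single i e = m - Pi.single i (e + 1) := by
      rw [tsub_tsub, ← Pi.single_add, add_comm 1 e]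
    rw [hsub]
    split_ifs <;> first | rfl | omega

theorem annih_pow_apply {N : ℕ} (i : Fin (N + 1)) (e : ℕ) (f : State N)
    (m : Fin (N + 1) → ℕ) : (annih i ^ e) f m = f (m + Pi.single i e) := by
  induction e generalizing m with
  | zero => simp
  | succ e ih =>
    rw [pow_succ', Module.End.mul_apply, annih_apply, ih, add_assoc, ← Pi.single_add,
      add_comm 1 e]

theorem commute_create_annih {N : ℕ} {i j : Fin (N + 1)} (h : i ≠ j) :
    Commute (create i) (annih j) := by
  refine LinearMap.ext fun f => Finsupp.ext fun m => ?_
  simp only [Module.End.mul_apply, create_apply, annih_apply, Pi.add_apply, Pi.single_eq_of_ne h,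
    add_zero]
  split_ifs with hm
  · rw [tsub_add_eq_add_tsub (single_le_iff.mpr hm)]
  · rfl

theorem plac_pow_apply {N : ℕ} (j : Fin N) (e : ℕ) (f : State N) (m : Fin (N + 1) → ℕ) :
    (plac j ^ e) f m = if e ≤ m j.succ then
      f (m - Pi.single j.succ e + Pi.single j.castSucc e) else 0 := by
  rw [plac, (commute_create_annih j.castSucc_lt_succ.ne').mul_pow, Module.End.mul_apply,
    create_pow_apply, annih_pow_apply]

theorem toState_apply {N k : ℕ} (f : Weight N k → ℂ) (m : Fin (N + 1) → ℕ) :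
    toState f m = if h : ∑ i, m i = k then f ⟨m, h⟩ else 0 := by
  simp only [toState, Finsupp.finsetSum_apply, Finsupp.smul_apply, ket_apply, smul_eq_mul,
    mul_ite, mul_one, mul_zero]
  split_ifs with h
  · rw [Finset.sum_eq_single ⟨m, h⟩ (fun b _ hb => if_neg fun h' => hb (Subtype.ext h'))
      (by simp), if_pos rfl]
  · exact Finset.sum_eq_zero fun b _ => if_neg fun h' => h (by rw [← h', b.2])

theorem toState_val {N k : ℕ} (f : Weight N k → ℂ) (m : Weight N k) : toState f m.1 = f m := by
  rw [toState_apply, dif_pos m.2]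

/-- The positions `∑_{j ≥ i} m_j + N - i` of `N + 1` particles on a line whose successive gaps are
the labels `m_i`; up to a common shift these are the coordinates of `λ + ρ`. -/
def pos {N : ℕ} (m : Fin (N + 1) → ℕ) (i : Fin (N + 1)) : ℤ :=
  ∑ j with i ≤ j, (m j : ℤ) + (N - i)

theorem pos_last {N : ℕ} (m : Fin (N + 1) → ℕ) : pos m (Fin.last N) = m (Fin.last N) := by
  have : (Finset.univ.filter fun j : Fin (N + 1) => Fin.last N ≤ j) = {Fin.last N} := by
    ext j; simp [Fin.last_le_iff]
  rw [pos, this]; simp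

theorem pos_castSucc {N : ℕ} (m : Fin (N + 1) → ℕ) (i : Fin N) :
    pos m i.castSucc = pos m i.succ + m i.castSucc + 1 := by
  have : (Finset.univ.filter fun j : Fin (N + 1) => i.castSucc ≤ j) =
      insert i.castSucc (Finset.univ.filter fun j : Fin (N + 1) => i.succ ≤ j) := by
    ext j
    simp only [Finset.mem_filter, Finset.mem_univ, true_and, Finset.mem_insert, Fin.le_def,
      Fin.ext_iff, Fin.val_succ, Fin.val_castSucc]
    omega
  rw [pos, this, Finset.sum_insert (by simp [Fin.le_def]), pos]
  simp only [Fin.val_succ, Fin.val_castSucc]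
  push_cast
  ring

theorem pos_zero {N : ℕ} (m : Fin (N + 1) → ℕ) : pos m 0 = (∑ i, m i : ℕ) + N := by
  simp [pos]

theorem pos_eq_of_gaps {N : ℕ} {m : Fin (N + 1) → ℕ} {l : Fin (N + 1) → ℤ}
    (hlast : l (Fin.last N) = m (Fin.last N))
    (hgap : ∀ i : Fin N, l i.castSucc = l i.succ + m i.castSucc + 1) : pos m = l := by
  funext i
  induction i using Fin.reverseInduction with
  | last => rw [pos_last, hlast]
  | cast i ih => rw [pos_castSucc, ih, hgap]

theorem pos_add_single {N : ℕ} (m : Fin (N + 1) → ℕ) (a i : Fin (N + 1)) (e : ℕ) :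
    pos (m + Pi.single a e) i = pos m i + if i ≤ a then (e : ℤ) else 0 := by
  simp only [pos, Pi.add_apply, Nat.cast_add, Finset.sum_add_distrib, Pi.single_apply,
    Nat.cast_ite, Nat.cast_zero, Finset.sum_ite_eq', Finset.mem_filter, Finset.mem_univ, true_and]
  ring

theorem sum_add_single {N : ℕ} (m : Fin (N + 1) → ℕ) (a : Fin (N + 1)) (e : ℕ) :
    ∑ i, (m + Pi.single a e : Fin (N + 1) → ℕ) i = ∑ i, m i + e := by
  simp [Finset.sum_add_distrib]

theorem pos_sub_single_zero {N : ℕ} {m : Fin (N + 1) → ℕ} (h : 1 ≤ m 0) :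
    pos (m - Pi.single 0 1) = pos m - Pi.single 0 1 := by
  obtain ⟨m, rfl⟩ := exists_add_of_le (single_le_iff.mpr h)
  funext i
  rw [add_comm (Pi.single 0 1) m, add_tsub_cancel_right, Pi.sub_apply, pos_add_single]
  simp [Pi.single_apply]

theorem pos_sub_single_succ {N : ℕ} {m : Fin (N + 1) → ℕ} {t : Fin N} (h : 1 ≤ m t.succ) :
    pos (m - Pi.single t.succ 1 + Pi.single t.castSucc 1) = pos m - Pi.single t.succ 1 := by
  obtain ⟨m, rfl⟩ := exists_add_of_le (single_le_iff.mpr h)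
  funext i
  rw [add_comm (Pi.single t.succ 1), add_tsub_cancel_right, Pi.sub_apply, pos_add_single,
    pos_add_single, Pi.single_apply]
  simp only [Fin.le_def, Fin.ext_iff, Fin.val_succ, Fin.val_castSucc, Nat.cast_one]
  split_ifs <;> omega

theorem sum_sub_single_succ {N : ℕ} {m : Fin (N + 1) → ℕ} {t : Fin N} (h : 1 ≤ m t.succ) :
    ∑ i, (m - Pi.single t.succ 1 + Pi.single t.castSucc 1 : Fin (N + 1) → ℕ) i = ∑ i, m i := by
  obtain ⟨m, rfl⟩ := exists_add_of_le (single_le_iff.mpr h)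
  rw [add_comm (Pi.single t.succ 1), add_tsub_cancel_right, sum_add_single, sum_add_single]

/-- The vector of level `d` whose coordinates are a function of the particle positions. -/
def levelVec {N : ℕ} (d : ℕ) (Φ : (Fin (N + 1) → ℤ) → ℂ) : State N :=
  toState fun m : Weight N d => Φ (pos m.1)

theorem levelVec_apply {N : ℕ} (d : ℕ) (Φ : (Fin (N + 1) → ℤ) → ℂ) (m : Fin (N + 1) → ℕ) :
    levelVec d Φ m = if ∑ i, m i = d then Φ (pos m) else 0 := by
  rw [levelVec, toState_apply]
  split_ifs <;> rfl

theorem levelVec_congr {N d : ℕ} {Φ Ψ : (Fin (N + 1) → ℤ) → ℂ}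
    (h : ∀ m : Weight N d, Φ (pos m.1) = Ψ (pos m.1)) : levelVec d Φ = levelVec d Ψ :=
  congrArg toState (funext h)

theorem levelVec_add {N : ℕ} (d : ℕ) (Φ Ψ : (Fin (N + 1) → ℤ) → ℂ) :
    levelVec d (Φ + Ψ) = levelVec d Φ + levelVec d Ψ := by
  simp [levelVec, toState, add_smul, Finset.sum_add_distrib]

theorem levelVec_smul {N : ℕ} (d : ℕ) (c : ℂ) (Φ : (Fin (N + 1) → ℤ) → ℂ) :
    levelVec d (c • Φ) = c • levelVec d Φ := by
  simp [levelVec, toState, mul_smul, Finset.smul_sum]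

-- A vanishing hypothesis stands for the exclusion principle: the move would put two particles on
-- the same site, or one particle on the site `-1`.
theorem plac_levelVec {N d : ℕ} {t : Fin N} {Φ : (Fin (N + 1) → ℤ) → ℂ}
    (h : ∀ m : Weight N d, m.1 t.succ = 0 → Φ (pos m.1 - Pi.single t.succ 1) = 0) :
    plac t (levelVec d Φ) = levelVec d fun l => Φ (l - Pi.single t.succ 1) := by
  ext m
  rw [← pow_one (plac t), plac_pow_apply, levelVec_apply, levelVec_apply]
  split_ifs with hm hs hd hd hd
  · rw [pos_sub_single_succ hm]
  · exact absurd ((sum_sub_single_succ hm).symm.trans hs) hd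
  · exact absurd ((sum_sub_single_succ hm).trans hd) hs
  · rfl
  · exact (h ⟨m, hd⟩ (Nat.lt_one_iff.mp (not_le.mp hm))).symm
  · rfl

theorem create_zero_levelVec {N d : ℕ} {Φ : (Fin (N + 1) → ℤ) → ℂ}
    (h : ∀ m : Weight N (d + 1), m.1 0 = 0 → Φ (pos m.1 - Pi.single 0 1) = 0) :
    create 0 (levelVec d Φ) = levelVec (d + 1) fun l => Φ (l - Pi.single 0 1) := by
  ext m
  rw [create_apply, levelVec_apply, levelVec_apply]
  by_cases hm : 1 ≤ m 0
  · have hsum : ∑ i, (m - Pi.single 0 1 : Fin (N + 1) → ℕ) i = d ↔ ∑ i, m i = d + 1 := by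
      have := sum_add_single (m - Pi.single 0 1) 0 1
      rw [tsub_add_cancel_of_le (single_le_iff.mpr hm)] at this
      omega
    simp only [if_pos hm, hsum, pos_sub_single_zero hm]
  · rw [if_neg hm]
    split_ifs with hd
    · exact (h ⟨m, hd⟩ (Nat.lt_one_iff.mp (not_le.mp hm))).symm
    · rfl

theorem annih_last_levelVec {N d : ℕ} (Φ : (Fin (N + 1) → ℤ) → ℂ) :
    annih (Fin.last N) (levelVec (d + 1) Φ) = levelVec d fun l => Φ (l + 1) := by
  ext m
  have hpos : pos (m + Pi.single (Fin.last N) 1) = pos m + 1 := by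
    funext i
    simp [pos_add_single, Fin.le_last]
  rw [annih_apply, levelVec_apply, levelVec_apply, sum_add_single, hpos]
  simp only [add_left_inj]

/-! ## Slater determinants and `T(u)` -/

theorem list_prod_ofFn_rev_apply {R V : Type*} [Semiring R] [AddCommMonoid V] [Module R V] {n : ℕ}
    (X : Fin n → Module.End R V) (v : Fin (n + 1) → V)
    (h : ∀ j, X j (v j.castSucc) = v j.succ) :
    (List.ofFn fun j => X j.rev).prod (v 0) = v (Fin.last n) := by
  induction n with
  | zero => simp
  | succ n ih =>
    have hinit := ih (fun j => X j.castSucc) (fun j => v j.castSucc) fun j => h j.castSucc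
    rw [List.ofFn_succ, List.prod_cons, Fin.rev_zero, Module.End.mul_apply]
    simp only [Fin.rev_succ]
    rw [← Fin.castSucc_zero, hinit, h, Fin.succ_last]

/-- The rows of a determinantal state after the first `t` factors of `A(u)` have acted: the rows
`f (l i)` with `i ≤ t` are replaced by `f (l i) + u • f (l i - 1)`, and row `0` is pinned to `r`. -/
def stripMatrix {N : ℕ} (f : ℤ → Fin (N + 1) → ℂ) (r : Fin (N + 1) → ℂ) (u : ℂ) (t : Fin (N + 1))
    (l : Fin (N + 1) → ℤ) : Matrix (Fin (N + 1)) (Fin (N + 1)) ℂ :=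
  (Matrix.of fun i => if i ≤ t then f (l i) + u • f (l i - 1) else f (l i)).updateRow 0 r

section Strip

variable {N : ℕ} {f : ℤ → Fin (N + 1) → ℂ} {r : Fin (N + 1) → ℂ} {u : ℂ}

theorem stripMatrix_row_of_lt {t i : Fin (N + 1)} (h : t < i) (l : Fin (N + 1) → ℤ) :
    stripMatrix f r u t l i = f (l i) := by
  rw [stripMatrix, Matrix.updateRow_ne (Fin.ne_zero_of_lt h)]
  exact if_neg h.not_ge

theorem stripMatrix_sub_single (s : Fin N) (l : Fin (N + 1) → ℤ) :
    stripMatrix f r u s.castSucc (l - Pi.single s.succ 1) =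
      (stripMatrix f r u s.castSucc l).updateRow s.succ (f (l s.succ - 1)) := by
  ext i j
  obtain rfl | hs := eq_or_ne i s.succ
  · rw [stripMatrix_row_of_lt s.castSucc_lt_succ]
    simp
  · obtain rfl | h0 := eq_or_ne i 0
    · rw [Matrix.updateRow_ne hs, stripMatrix, stripMatrix, Matrix.updateRow_self,
        Matrix.updateRow_self]
    · simp [stripMatrix, Matrix.updateRow_ne h0, hs]

theorem stripMatrix_succ (s : Fin N) (l : Fin (N + 1) → ℤ) :
    stripMatrix f r u s.succ l = (stripMatrix f r u s.castSucc l).updateRow s.succ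
      (f (l s.succ) + u • f (l s.succ - 1)) := by
  ext i j
  obtain rfl | hs := eq_or_ne i s.succ
  · simp [stripMatrix]
  · have hle : i ≤ s.succ ↔ i ≤ s.castSucc := by
      simp only [Fin.le_def, Fin.val_succ, Fin.val_castSucc, ne_eq, Fin.ext_iff] at hs ⊢
      omega
    obtain rfl | h0 := eq_or_ne i 0
    · rw [Matrix.updateRow_ne hs, stripMatrix, stripMatrix, Matrix.updateRow_self,
        Matrix.updateRow_self]
    · simp [stripMatrix, Matrix.updateRow_ne h0, Matrix.updateRow_ne hs, hle]

theorem det_stripMatrix_succ (s : Fin N) (l : Fin (N + 1) → ℤ) :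
    (stripMatrix f r u s.succ l).det = (stripMatrix f r u s.castSucc l).det +
      u * (stripMatrix f r u s.castSucc (l - Pi.single s.succ 1)).det := by
  rw [stripMatrix_succ, Matrix.det_updateRow_add, Matrix.det_updateRow_smul,
    ← stripMatrix_sub_single,
    ← stripMatrix_row_of_lt (f := f) (r := r) (u := u) s.castSucc_lt_succ l,
    Matrix.updateRow_eq_self]

theorem det_stripMatrix_eq_zero {c : ℂ} (hc : f (-1) = c • r) {s : Fin N}
    {m : Fin (N + 1) → ℕ} (hm : m s.succ = 0) :
    (stripMatrix f r u s.castSucc (pos m - Pi.single s.succ 1)).det = 0 := by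
  rw [stripMatrix_sub_single]
  obtain ⟨q, hq⟩ | hlast := s.succ.eq_castSucc_or_eq_last
  · have hpos : pos m s.succ - 1 = pos m q.succ := by
      rw [hq, pos_castSucc, ← hq, hm]; simp
    have hlt : s.succ < q.succ := hq ▸ q.castSucc_lt_succ
    apply Matrix.det_zero_of_row_eq hlt.ne
    rw [Matrix.updateRow_self, Matrix.updateRow_ne hlt.ne', hpos,
      stripMatrix_row_of_lt (s.castSucc_lt_succ.trans hlt)]
  · have hpos : pos m s.succ - 1 = -1 := by rw [hlast, pos_last, ← hlast, hm]; simp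
    rw [hpos, hc, Matrix.det_updateRow_smul, Matrix.det_zero_of_row_eq (Fin.succ_ne_zero s),
      mul_zero]
    rw [Matrix.updateRow_self, Matrix.updateRow_ne (Fin.succ_ne_zero s).symm, stripMatrix,
      Matrix.updateRow_self]

theorem opA_levelVec_updateRow {c : ℂ} (hc : f (-1) = c • r) (u : ℂ) (d : ℕ) :
    opA u (levelVec d fun l => ((Matrix.of fun i => f (l i)).updateRow 0 r).det) =
      levelVec d fun l =>
        ((Matrix.of fun i => f (l i) + u • f (l i - 1)).updateRow 0 r).det := by
  have hfirst (l) : stripMatrix f r u 0 l = (Matrix.of fun i => f (l i)).updateRow 0 r := by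
    ext i j
    obtain rfl | h := eq_or_ne i 0 <;> simp [stripMatrix, Matrix.updateRow_ne, *]
  have hlast (l) : stripMatrix f r u (Fin.last N) l =
      (Matrix.of fun i => f (l i) + u • f (l i - 1)).updateRow 0 r := by
    simp [stripMatrix, Fin.le_last]
  simp only [← hfirst, ← hlast]
  refine list_prod_ofFn_rev_apply (fun s => 1 + u • plac s)
    (fun t => levelVec d fun l => (stripMatrix f r u t l).det) fun s => ?_
  rw [LinearMap.add_apply, Module.End.one_apply, LinearMap.smul_apply,
    plac_levelVec fun m hm => det_stripMatrix_eq_zero hc hm, ← levelVec_smul, ← levelVec_add]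
  exact congrArg (levelVec d) (funext fun l => (det_stripMatrix_succ s l).symm)

theorem updateRow_zero_pos {d : ℕ} {f : ℤ → Fin (N + 1) → ℂ} (m : Weight N d) :
    (Matrix.of fun i => f (pos m.1 i)).updateRow 0 (f (d + N)) =
      Matrix.of fun i => f (pos m.1 i) := by
  have : f (d + N) = (Matrix.of fun i => f (pos m.1 i)) 0 := by
    change _ = f (pos m.1 0)
    rw [pos_zero, m.2]
  rw [this, Matrix.updateRow_eq_self]

theorem opA_levelVec {c : ℂ} {d : ℕ} (hc : f (-1) = c • f (d + N)) (u : ℂ) :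
    opA u (levelVec d fun l => (Matrix.of fun i => f (l i)).det) = levelVec d fun l =>
      ((Matrix.of fun i => f (l i) + u • f (l i - 1)).updateRow 0 (f (d + N))).det := by
  rw [← opA_levelVec_updateRow hc]
  exact congrArg _ (levelVec_congr fun m => by rw [updateRow_zero_pos])

theorem create_zero_levelVec_det (hN : 1 ≤ N) (f : ℤ → Fin (N + 1) → ℂ) (d : ℕ) :
    create 0 (levelVec d fun l => (Matrix.of fun i => f (l i)).det) = levelVec (d + 1) fun l =>
      ((Matrix.of fun i => f (l i)).updateRow 0 (f (d + N))).det := by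
  have hshift (m : Weight N (d + 1)) :
      (Matrix.of fun i => f ((pos m.1 - Pi.single 0 1 : Fin (N + 1) → ℤ) i)) =
      (Matrix.of fun i => f (pos m.1 i)).updateRow 0 (f (d + N)) := by
    ext i j
    obtain rfl | h := eq_or_ne i 0
    · have : pos m.1 0 - 1 = d + N := by rw [pos_zero, m.2]; push_cast; ring
      simp [this]
    · simp [h]
  rw [create_zero_levelVec fun m hm => ?_]
  · exact levelVec_congr fun m => by rw [hshift]
  · obtain ⟨M, rfl⟩ := Nat.exists_eq_add_of_le' hN
    have hpos := pos_castSucc m.1 0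
    rw [Fin.castSucc_zero, pos_zero, m.2, hm] at hpos
    rw [hshift]
    apply Matrix.det_zero_of_row_eq (Fin.succ_ne_zero 0).symm
    rw [Matrix.updateRow_self, Matrix.updateRow_ne (Fin.succ_ne_zero 0)]
    change f _ = f _
    congr 1
    push_cast at hpos ⊢
    omega

theorem opA_create_zero_levelVec (hN : 1 ≤ N) {c : ℂ} {d : ℕ} (hc : f (-1) = c • f (d + N))
    (u : ℂ) :
    opA u (create 0 (levelVec d fun l => (Matrix.of fun i => f (l i)).det)) =
      levelVec (d + 1) fun l =>
        ((Matrix.of fun i => f (l i) + u • f (l i - 1)).updateRow 0 (f (d + N))).det := by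
  rw [create_zero_levelVec_det hN, opA_levelVec_updateRow hc]

end Strip

theorem ne_zero_of_prod_eq_one {ι M : Type*} [Fintype ι] [CommMonoidWithZero M] [Nontrivial M]
    {y : ι → M} (hy : ∏ j, y j = 1) (j : ι) : y j ≠ 0 := fun h =>
  one_ne_zero (hy.symm.trans (Finset.prod_eq_zero (Finset.mem_univ j) h))

/-- The Slater determinant `det (y_j ^ l_i)` of `N + 1` free fermions. -/
def slater {K : Type*} [Field K] {N : ℕ} (y : Fin (N + 1) → K) (l : Fin (N + 1) → ℤ) : K :=
  (Matrix.of fun i j => y j ^ l i).det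

theorem slater_add_const {K : Type*} [Field K] {N : ℕ} {y : Fin (N + 1) → K}
    (hy : ∏ j, y j = 1) (l : Fin (N + 1) → ℤ) (c : ℤ) :
    slater y (fun i => l i + c) = slater y l := by
  have hy0 := ne_zero_of_prod_eq_one hy
  have hscale := Matrix.det_mul_row (fun j => y j ^ c) (Matrix.of fun i j => y j ^ l i)
  rw [Finset.prod_zpow, hy, one_zpow, one_mul] at hscale
  rw [slater, slater, ← hscale]
  congr 1
  ext i j
  simp [zpow_add₀ (hy0 j), mul_comm]

/-- The plane wave of level `k` with momenta `y`: its coordinates are the Slater determinants of the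
particle positions. -/
def wave {N : ℕ} (k : ℕ) (y : Fin (N + 1) → ℂ) : State N := levelVec k (slater y)

theorem wave_eq_det {N : ℕ} (k : ℕ) (y : Fin (N + 1) → ℂ) :
    wave k y = levelVec k fun l => (Matrix.of fun i j => y j ^ l i).det := rfl

theorem opD_wave {N k : ℕ} (hN : 1 ≤ N) {y : Fin (N + 1) → ℂ} (hy : ∏ j, y j = 1) {c : ℂ}
    (hc : ∀ j, y j ^ (-1 : ℤ) = c * y j ^ (k + N : ℤ)) (u : ℂ) :
    opD u (wave k y) = u • levelVec k fun l => ((Matrix.of fun i j =>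
      y j ^ l i + u * y j ^ (l i - 1)).updateRow 0 fun j => y j ^ (k + N - 1 : ℤ)).det := by
  have hy0 := ne_zero_of_prod_eq_one hy
  have hA := opA_create_zero_levelVec hN (f := fun l j => y j ^ l) (funext hc) u
  rw [opD, LinearMap.smul_apply, Module.End.mul_apply, Module.End.mul_apply, wave_eq_det, hA,
    annih_last_levelVec]
  refine congrArg (u • ·) (levelVec_congr fun m => ?_)
  have hscale := Matrix.det_mul_row y ((Matrix.of fun i j => y j ^ pos m.1 i +
    u * y j ^ (pos m.1 i - 1)).updateRow 0 fun j => y j ^ (k + N - 1 : ℤ))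
  rw [hy, one_mul] at hscale
  rw [← hscale]
  congr 1
  ext i j
  obtain rfl | h := eq_or_ne i 0
  · simp [← zpow_one_add₀ (hy0 j)]
  · simp [Matrix.updateRow_ne h, mul_add, mul_left_comm (y j), ← zpow_one_add₀ (hy0 j),
      add_comm (1 : ℤ)]

theorem opT_wave {N k : ℕ} (hN : 1 ≤ N) {y : Fin (N + 1) → ℂ} (hy : ∏ j, y j = 1) {κ : ℂ}
    (hκ : ∀ j, y j ^ (k + (N + 1)) = κ) (u : ℂ) :
    opT 1 u (wave k y) = (∏ j, (1 + u * (y j)⁻¹)) • wave k y := by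
  have hy0 := ne_zero_of_prod_eq_one hy
  have hc (j) : y j ^ (-1 : ℤ) = κ⁻¹ * y j ^ (k + N : ℤ) := by
    rw [← hκ j, ← zpow_natCast, ← zpow_neg, ← zpow_add₀ (hy0 j)]
    congr 1
    push_cast
    ring
  have hA := opA_levelVec (f := fun l j => y j ^ l) (funext hc) u
  rw [opT, one_smul, LinearMap.add_apply, opD_wave hN hy hc, wave_eq_det, hA,
    ← levelVec_smul, ← levelVec_smul, ← levelVec_add]
  refine levelVec_congr fun m => ?_
  simp only [Pi.add_apply, Pi.smul_apply, smul_eq_mul]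
  rw [← Matrix.det_mul_row, ← Matrix.det_updateRow_smul]
  refine (Matrix.det_updateRow_add ..).symm.trans ?_
  congr 1
  ext i j
  obtain rfl | h := eq_or_ne i 0
  · simp [pos_zero, m.2, zpow_sub_one₀ (hy0 j)]
    ring
  · simp [Matrix.updateRow_ne h, zpow_sub_one₀ (hy0 j)]
    ring

/-- The coefficients of a power series indexed by `ℤ`, equal to `0` in negative degrees. -/
def intCoeff {R : Type*} [CommRing R] (d : ℤ) : PowerSeries R →ₗ[R] R :=
  if d < 0 then 0 else PowerSeries.coeff d.toNat

section IntCoeff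

variable {R : Type*} [CommRing R]

theorem intCoeff_of_neg {d : ℤ} (h : d < 0) (φ : PowerSeries R) : intCoeff d φ = 0 := by
  rw [intCoeff, if_pos h, LinearMap.zero_apply]

theorem intCoeff_natCast (n : ℕ) : intCoeff n = PowerSeries.coeff (R := R) n := by
  simp [intCoeff]

theorem intCoeff_of_nonneg {d : ℤ} (h : 0 ≤ d) :
    intCoeff d = PowerSeries.coeff (R := R) d.toNat := if_neg h.not_gt

theorem intCoeff_one (d : ℤ) : intCoeff d (1 : PowerSeries R) = if d = 0 then 1 else 0 := by
  obtain h | h := lt_or_ge d 0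
  · rw [intCoeff_of_neg h, if_neg h.ne]
  · rw [intCoeff_of_nonneg h, PowerSeries.coeff_one]
    simp only [Int.toNat_eq_zero, h.ge_iff_eq']

theorem intCoeff_C_mul_X_pow_mul (a : R) (n : ℕ) (φ : PowerSeries R) (d : ℤ) :
    intCoeff d (PowerSeries.C a * PowerSeries.X ^ n * φ) = a * intCoeff (d - n) φ := by
  rw [mul_assoc, ← PowerSeries.smul_eq_C_mul, map_smul, smul_eq_mul]
  congr 1
  obtain h | h := lt_or_ge d 0
  · rw [intCoeff_of_neg h, intCoeff_of_neg (by omega)]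
  rw [intCoeff_of_nonneg h, PowerSeries.coeff_X_pow_mul']
  split_ifs with hn
  · rw [intCoeff_of_nonneg (by omega)]
    congr 2
    omega
  · rw [intCoeff_of_neg (by omega)]

end IntCoeff

/-- The elementary symmetric functions of a list, indexed by `ℤ`. -/
def elem {R : Type*} [CommRing R] (us : List R) (d : ℤ) : R :=
  intCoeff d (us.map fun u => 1 + PowerSeries.C u * PowerSeries.X).prod

theorem elem_cons {R : Type*} [CommRing R] (u : R) (us : List R) (d : ℤ) :
    elem (u :: us) d = elem us d + u * elem us (d - 1) := by
  have h := intCoeff_C_mul_X_pow_mul u 1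
    (us.map fun u => 1 + PowerSeries.C u * PowerSeries.X).prod d
  rw [pow_one, Nat.cast_one] at h
  rw [elem, List.map_cons, List.prod_cons, add_mul, one_mul, map_add, h, elem, elem]

theorem elem_of_length_lt {R : Type*} [CommRing R] (us : List R) {d : ℤ} (h : us.length < d) :
    elem us d = 0 := by
  induction us generalizing d with
  | nil =>
    rw [List.length_nil, Nat.cast_zero] at h
    rw [elem, List.map_nil, List.prod_nil, intCoeff_one, if_neg h.ne']
  | cons u us ih =>
    rw [List.length_cons] at h
    push_cast at h
    rw [elem_cons, ih (by omega), ih (by omega), mul_zero, add_zero]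

theorem ket_zero_eq_levelVec {N : ℕ} : ket (0 : Fin (N + 1) → ℕ) = levelVec 0 fun l =>
    (Matrix.of fun i j : Fin (N + 1) => elem ([] : List ℂ) (l i - N + j)).det := by
  ext m
  have hm : 0 = m ↔ ∑ i, m i = 0 := by
    simp [Finset.sum_eq_zero_iff, funext_iff, eq_comm (a := (0 : ℕ))]
  rw [ket_apply, levelVec_apply]
  simp only [hm]
  split_ifs with h
  · obtain rfl := hm.mpr h
    rw [← Matrix.det_one (n := Fin (N + 1)) (R := ℂ)]
    congr 1
    ext i j
    have hpos : pos (0 : Fin (N + 1) → ℕ) i - N + j = j - i := by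
      simp [pos]; ring
    rw [Matrix.of_apply, hpos, Matrix.one_apply, elem, List.map_nil, List.prod_nil, intCoeff_one]
    simp only [sub_eq_zero, Nat.cast_inj, Fin.ext_iff, eq_comm]
  · rfl

theorem opB_prod_ket_zero {N : ℕ} (hN : 1 ≤ N) (us : List ℂ) :
    (us.map (opB (N := N))).prod (ket 0) = levelVec us.length fun l =>
      (Matrix.of fun i j : Fin (N + 1) => elem us (l i - N + j)).det := by
  induction us with
  | nil => exact ket_zero_eq_levelVec
  | cons u us ih =>
    have hc : (fun j : Fin (N + 1) => elem us (-1 - N + j)) =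
        (0 : ℂ) • fun j : Fin (N + 1) => elem us (us.length + N - N + j) := by
      funext j
      rw [zero_smul]
      exact intCoeff_of_neg (by omega) _
    have hA := opA_create_zero_levelVec hN (f := fun l j => elem us (l - N + j)) hc u
    rw [List.map_cons, List.prod_cons, Module.End.mul_apply, opB, LinearMap.smul_apply,
      Module.End.mul_apply, ih, hA, ← levelVec_smul, List.length_cons]
    refine levelVec_congr fun m => ?_
    rw [Pi.smul_apply, smul_eq_mul, ← Matrix.det_updateRow_smul]
    congr 1
    ext i j
    rw [Matrix.of_apply, elem_cons]
    obtain rfl | h := eq_or_ne i 0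
    · have hpos : pos m.1 0 = us.length + 1 + N := by rw [pos_zero, m.2]; push_cast; ring
      rw [elem_of_length_lt us (by omega), zero_add, Matrix.updateRow_self, Pi.smul_apply,
        smul_eq_mul, hpos]
      congr 2
      ring
    · simp only [Matrix.updateRow_ne h, Matrix.of_apply, Pi.add_apply, Pi.smul_apply, smul_eq_mul]
      congr 3
      ring

/-! ## The action of `h_r(𝓐)` -/

/-- The labels obtained by moving `ε_i` particles from node `i` to node `i - 1`, cyclically. -/
def moved {N : ℕ} (m ε : Fin (N + 1) → ℕ) : Fin (N + 1) → ℕ := fun i => m i - ε i + ε (i + 1)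

theorem moved_add {N : ℕ} {m ε : Fin (N + 1) → ℕ} (h : ε ≤ m) (p : Fin (N + 1) → ℕ) :
    moved (m + p) ε = moved m ε + p := by
  funext i
  have : ε i ≤ m i := h i
  simp only [moved, Pi.add_apply]
  omega

theorem moved_single_add {N : ℕ} {m ε : Fin (N + 1) → ℕ} {a : Fin (N + 1)} {e : ℕ} :
    moved m (Pi.single (a + 1) e + ε) = moved (m - Pi.single (a + 1) e) ε + Pi.single a e := by
  funext i
  have : (Pi.single (a + 1) e : Fin (N + 1) → ℕ) (i + 1) =
      (Pi.single a e : Fin (N + 1) → ℕ) i := by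
    simp [Pi.single_apply]
  simp only [moved, Pi.add_apply, Pi.sub_apply, this]
  omega

open scoped Classical in
theorem list_prod_plac_pow_apply {N : ℕ} (ε : Fin N → ℕ) (f : State N) {L : List (Fin N)}
    (hL : L.Pairwise (· < ·)) (m : Fin (N + 1) → ℕ) :
    (L.map fun j => plac j ^ ε j).prod f m =
      if (L.map fun j => Pi.single j.succ (ε j)).sum ≤ m
      then f (moved m (L.map fun j => Pi.single j.succ (ε j)).sum) else 0 := by
  induction L generalizing m with
  | nil =>
    have : moved m 0 = m := by funext i; simp [moved]
    simp [this]
  | cons j L ih =>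
    obtain ⟨hj, hL⟩ := List.pairwise_cons.mp hL
    rw [List.map_cons, List.prod_cons, Module.End.mul_apply, plac_pow_apply, ih hL, List.map_cons,
      List.sum_cons]
    set S := (L.map fun j => (Pi.single j.succ (ε j) : Fin (N + 1) → ℕ)).sum with hS
    have hS0 : S j.castSucc = 0 := by
      rw [hS, Pi.list_sum_apply, List.map_map]
      refine List.sum_eq_zero fun x hx => ?_
      obtain ⟨i, hi, rfl⟩ := List.mem_map.mp hx
      exact Pi.single_eq_of_ne (j.castSucc_lt_succ.trans (Fin.succ_lt_succ_iff.mpr (hj i hi))).ne _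
    have hle : S ≤ m - Pi.single j.succ (ε j) + Pi.single j.castSucc (ε j) ↔
        S ≤ m - Pi.single j.succ (ε j) := by
      refine forall_congr' fun i => ?_
      obtain rfl | hi := eq_or_ne i j.castSucc
      · simp [hS0]
      · simp [hi]
    rw [hle, ← Fin.coeSucc_eq_succ, moved_single_add]
    by_cases he : ε j ≤ m (j.castSucc + 1)
    · rw [if_pos he, le_tsub_iff_left (single_le_iff.mpr he)]
      split_ifs with h
      · rw [moved_add (le_tsub_of_add_le_left h)]
      · rfl
    · rw [if_neg he, if_neg fun h => he (single_le_iff.mp (le_self_add.trans h))]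

open scoped Classical in
theorem hOp_monomial_apply {N : ℕ} (ε : Fin (N + 1) → ℕ) (f : State N) (m : Fin (N + 1) → ℕ) :
    (create 0 ^ ε 0 * (List.ofFn fun j : Fin N => plac j ^ ε j.succ).prod *
      annih (Fin.last N) ^ ε 0 : Module.End ℂ (State N)) f m =
      if ε ≤ m then f (moved m ε) else 0 := by
  have hε : ε = Pi.single (Fin.last N + 1) (ε 0) +
      ((List.finRange N).map fun j : Fin N => Pi.single j.succ (ε j.succ)).sum := by
    rw [← List.ofFn_eq_map, List.sum_ofFn, Fin.last_add_one,
      ← Fin.sum_univ_succ fun i => (Pi.single i (ε i) : Fin (N + 1) → ℕ), Finset.univ_sum_single]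
  rw [Module.End.mul_apply, Module.End.mul_apply, create_pow_apply, List.ofFn_eq_map,
    list_prod_plac_pow_apply (fun j => ε j.succ) _ (List.pairwise_lt_finRange N), annih_pow_apply]
  conv_rhs => rw [hε, moved_single_add, Fin.last_add_one]
  by_cases h0 : ε 0 ≤ m 0
  · rw [if_pos h0, le_tsub_iff_left (single_le_iff.mpr h0)]
  · rw [if_neg h0, if_neg fun h => h0 (single_le_iff.mp (le_self_add.trans h))]

theorem hOp_apply {N : ℕ} (r : ℕ) (f : State N) (m : Fin (N + 1) → ℕ) :
    hOp 1 r f m = ∑ ε ∈ Finset.Iic m with ∑ i, ε i = r, f (moved m ε) := by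
  classical
  have hset : {ε ∈ Finset.Iic m | ∑ i, ε i = r} =
      {ε ∈ Finset.piAntidiag (Finset.univ : Finset (Fin (N + 1))) r | ε ≤ m} := by
    ext ε
    simp [and_comm]
  simp only [hOp, one_pow, one_smul]
  rw [LinearMap.sum_apply, Finsupp.finsetSum_apply, hset, Finset.sum_filter]
  exact Finset.sum_congr rfl fun ε _ => hOp_monomial_apply ε f m

theorem pos_moved {N : ℕ} {m ε : Fin (N + 1) → ℕ} (h : ε ≤ m) :
    pos (moved m ε) = fun i => pos m i - ε i + ε 0 := by
  refine pos_eq_of_gaps ?_ fun i => ?_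
  · have : ε (Fin.last N) ≤ m (Fin.last N) := h _
    rw [pos_last, moved, Fin.last_add_one]
    omega
  · have : ε i.castSucc ≤ m i.castSucc := h _
    rw [pos_castSucc, moved, Fin.coeSucc_eq_succ]
    omega

theorem sum_moved {N : ℕ} {m ε : Fin (N + 1) → ℕ} (h : ε ≤ m) :
    ∑ i, moved m ε i = ∑ i, m i := by
  have h0 := congrFun (pos_moved h) 0
  rw [pos_zero, pos_zero] at h0
  omega

/-! ## Complete symmetric functions -/

section CompleteSymmetric

variable {R : Type*} [CommRing R]

theorem intCoeff_coe_mul {P : Polynomial R} {n : ℕ} (hP : P.natDegree ≤ n) (φ : PowerSeries R)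
    (d : ℤ) : intCoeff d ((P : PowerSeries R) * φ) =
      ∑ i : Fin (n + 1), P.coeff i * intCoeff (d - i) φ := by
  have hsum : (P : PowerSeries R) =
      ∑ i : Fin (n + 1), PowerSeries.C (P.coeff i) * PowerSeries.X ^ (i : ℕ) := by
    conv_lhs => rw [P.as_sum_range_C_mul_X_pow' (Nat.lt_succ_of_le hP), Finset.sum_range]
    simp only [← Polynomial.coeToPowerSeries.ringHom_apply, map_sum, map_mul, map_pow]
    simp only [Polynomial.coeToPowerSeries.ringHom_apply, Polynomial.coe_C, Polynomial.coe_X]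
  rw [hsum, Finset.sum_mul, map_sum]
  exact Finset.sum_congr rfl fun i _ => intCoeff_C_mul_X_pow_mul _ _ _ _

/-- The generating function of the complete symmetric functions. -/
def hSeries {ι : Type*} [Fintype ι] (y : ι → R) : PowerSeries R :=
  ∏ j, PowerSeries.mk fun r => y j ^ r

theorem one_sub_C_mul_X_mul_mk_pow (a : R) :
    (1 - PowerSeries.C a * PowerSeries.X) * PowerSeries.mk (fun r => a ^ r) = 1 := by
  have h := congrArg (PowerSeries.rescale a) (PowerSeries.mk_one_mul_one_sub_eq_one R)
  rw [map_mul, PowerSeries.rescale_mk, map_sub, map_one, PowerSeries.rescale_X, mul_comm] at h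
  simpa using h

theorem prod_one_sub_mul_hSeries {ι : Type*} [Fintype ι] (y : ι → R) :
    (∏ j, (1 - PowerSeries.C (y j) * PowerSeries.X)) * hSeries y = 1 := by
  rw [hSeries, ← Finset.prod_mul_distrib]
  exact Finset.prod_eq_one fun j _ => one_sub_C_mul_X_mul_mk_pow (y j)

/-- The complete symmetric functions indexed by the integers. -/
def complete {ι : Type*} [Fintype ι] (y : ι → R) (d : ℤ) : R := intCoeff d (hSeries y)

theorem complete_of_neg {ι : Type*} [Fintype ι] (y : ι → R) {d : ℤ} (h : d < 0) :
    complete y d = 0 :=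
  intCoeff_of_neg h _

theorem complete_zero {ι : Type*} [Fintype ι] (y : ι → R) : complete y 0 = 1 := by
  simp [complete, intCoeff, hSeries, map_prod]

theorem natDegree_prod_erase_one_sub_le {N : ℕ} (y : Fin (N + 1) → R) (p : Fin (N + 1)) :
    (∏ q ∈ Finset.univ.erase p, (1 - Polynomial.C (y q) * Polynomial.X)).natDegree ≤ N := by
  have hfactor (q : Fin (N + 1)) : (1 - Polynomial.C (y q) * Polynomial.X).natDegree ≤ 1 := by
    compute_degree
  refine (Polynomial.natDegree_prod_le _ _).trans ((Finset.sum_le_card_nsmul _ _ 1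
    fun q _ => hfactor q).trans ?_)
  simp

theorem pow_eq_sum_complete {N : ℕ} (y : Fin (N + 1) → R) (p : Fin (N + 1)) (l : ℕ) :
    y p ^ l = ∑ j : Fin (N + 1), complete y (l - N + j) *
      (∏ q ∈ Finset.univ.erase p, (1 - Polynomial.C (y q) * Polynomial.X)).coeff (N - j) := by
  have hgeom : ((∏ q ∈ Finset.univ.erase p, (1 - Polynomial.C (y q) * Polynomial.X) :
      Polynomial R) : PowerSeries R) * hSeries y = PowerSeries.mk fun r => y p ^ r := by
    have hp := one_sub_C_mul_X_mul_mk_pow (y p)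
    have hall := prod_one_sub_mul_hSeries y
    rw [← Finset.mul_prod_erase _ _ (Finset.mem_univ p)] at hall
    rw [← Polynomial.coeToPowerSeries.ringHom_apply, map_prod]
    simp only [map_sub, map_one, map_mul, Polynomial.coeToPowerSeries.ringHom_apply,
      Polynomial.coe_C, Polynomial.coe_X]
    linear_combination PowerSeries.mk (fun r => y p ^ r) * hall -
      (∏ q ∈ Finset.univ.erase p, (1 - PowerSeries.C (y q) * PowerSeries.X)) * hSeries y * hp
  have hcoeff := intCoeff_coe_mul (natDegree_prod_erase_one_sub_le y p) (hSeries y) l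
  rw [hgeom, intCoeff_natCast, PowerSeries.coeff_mk, ← Equiv.sum_comp Fin.revPerm] at hcoeff
  rw [hcoeff]
  refine Finset.sum_congr rfl fun j _ => ?_
  have hj := Nat.lt_succ_iff.mp j.2
  rw [Fin.revPerm_apply, Fin.val_rev, Nat.add_sub_add_right, Nat.cast_sub hj, mul_comm, complete]
  congr 2
  ring_nf

end CompleteSymmetric

theorem det_complete_mul_slater {K : Type*} [Field K] {N : ℕ} (y : Fin (N + 1) → K)
    {l : Fin (N + 1) → ℤ} (hl : ∀ i, 0 ≤ l i) :
    (Matrix.of fun i j : Fin (N + 1) => complete y (l i - N + j)).det *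
      slater y (fun i => N - i) = slater y l := by
  set E : Matrix (Fin (N + 1)) (Fin (N + 1)) K := Matrix.of fun j p =>
    (∏ q ∈ Finset.univ.erase p, (1 - Polynomial.C (y q) * Polynomial.X)).coeff (N - j)
  have hfactor {l : Fin (N + 1) → ℤ} (hl : ∀ i, 0 ≤ l i) :
      (Matrix.of fun i j : Fin (N + 1) => complete y (l i - N + j)).det * E.det = slater y l := by
    rw [← Matrix.det_mul, slater]
    congr 1
    ext i p
    lift l to Fin (N + 1) → ℕ using hl
    rw [Matrix.mul_apply, Matrix.of_apply, zpow_natCast, pow_eq_sum_complete]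
    simp [E]
  have hunit :
      (Matrix.of fun i j : Fin (N + 1) => complete y (((N : ℤ) - i) - N + j)).det = 1 := by
    rw [Matrix.det_of_isUpperTriangular]
    · refine Finset.prod_eq_one fun i _ => ?_
      rw [Matrix.of_apply, show ((N : ℤ) - i) - N + i = 0 by ring, complete_zero]
    · intro i j (hij : (j : ℕ) < i)
      rw [Matrix.of_apply, complete_of_neg]
      omega
  rw [← hfactor hl, ← hfactor (l := fun i => N - i) fun i => by have := i.2; omega, hunit, one_mul]

theorem det_eq_zero_of_row_eq_smul {n R : Type*} [DecidableEq n] [Fintype n] [CommRing R]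
    {M : Matrix n n R} {i j : n} (hij : i ≠ j) {c : R} (h : M i = c • M j) : M.det = 0 := by
  rw [← M.updateRow_eq_self i, h, Matrix.det_updateRow_smul,
    Matrix.det_updateRow_eq_zero hij.symm, mul_zero]

theorem eq_univ_of_succ_mem {N : ℕ} {S : Finset (Fin (N + 1))} (hS : S.Nonempty)
    (h : ∀ i, i + 1 ∈ S → i ∈ S) : S = Finset.univ := by
  obtain ⟨s, hs⟩ := hS
  have hzero (i) (hi : i ∈ S) : 0 ∈ S := by
    induction i using Fin.induction with
    | zero => exact hi
    | succ i ih => exact ih (h _ (by rwa [Fin.coeSucc_eq_succ]))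
  refine Finset.eq_univ_of_forall fun i => ?_
  induction i using Fin.reverseInduction with
  | last => exact h _ (by rw [Fin.last_add_one]; exact hzero s hs)
  | cast i ih => exact h _ (by rwa [Fin.coeSucc_eq_succ])

-- In the multilinear expansion, a term that keeps some but not all rows of `a` keeps some
-- `a (i + 1)` next to the proportional row `b i`, so only the two extreme terms survive.
theorem det_sub_cyclic {N : ℕ} {R : Type*} [CommRing R] (x : Fin (N + 1) → R)
    (a b : Fin (N + 1) → Fin (N + 1) → R) (c : Fin (N + 1) → R) (hb : ∀ i, b i = c i • a (i + 1)) :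
    (Matrix.of fun i => a i - x i • b i).det =
      (Matrix.of a).det + (∏ i, -x i) * (Matrix.of b).det := by
  set D := (Matrix.detRowAlternating (n := Fin (N + 1)) (R := R)).toMultilinearMap
  have hsub : (fun i => a i - x i • b i) = a + fun i => (-x i) • b i := by
    funext i
    simp [sub_eq_add_neg]
  have hmixed (S : Finset (Fin (N + 1))) (hS : S ≠ Finset.univ ∧ S ≠ ∅) :
      D (S.piecewise a fun i => (-x i) • b i) = 0 := by
    obtain ⟨i, hi, hi'⟩ : ∃ i, i + 1 ∈ S ∧ i ∉ S := by
      by_contra! hcon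
      exact hS.1 (eq_univ_of_succ_mem (Finset.nonempty_iff_ne_empty.mpr hS.2) hcon)
    have hne : i ≠ i + 1 := fun h => hi' (h ▸ hi)
    refine det_eq_zero_of_row_eq_smul (M := S.piecewise a _) hne (c := -x i * c i) ?_
    rw [Finset.piecewise_eq_of_notMem _ _ _ hi', Finset.piecewise_eq_of_mem _ _ _ hi, mul_smul,
      ← hb]
  change D (fun i => a i - x i • b i) = D a + (∏ i, -x i) * D b
  rw [hsub, D.map_add_univ, Finset.sum_eq_add_of_mem Finset.univ ∅ (Finset.mem_univ _)
    (Finset.mem_univ _) Finset.univ_nonempty.ne_empty fun S _ hS => hmixed S hS,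
    Finset.piecewise_univ, Finset.piecewise_empty, D.map_smul_univ, smul_eq_mul]

theorem coeff_det_sum_X_pow {ι R : Type*} [Fintype ι] [DecidableEq ι] [CommRing R] (m : ι → ℕ)
    (a : ι → ℕ → ι → R) (r : ℕ) :
    PowerSeries.coeff r (Matrix.of fun i j => ∑ e ∈ Finset.range (m i + 1),
      PowerSeries.X ^ e * PowerSeries.C (a i e j)).det =
    ∑ ε ∈ Finset.Iic m with ∑ i, ε i = r, (Matrix.of fun i => a i (ε i)).det := by
  set D := (Matrix.detRowAlternating (n := ι) (R := PowerSeries R)).toMultilinearMap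
  have hrows : (Matrix.of fun i j => ∑ e ∈ Finset.range (m i + 1),
      PowerSeries.X ^ e * PowerSeries.C (a i e j)).det =
      D fun i => ∑ e ∈ Finset.range (m i + 1),
        (PowerSeries.X ^ e : PowerSeries R) • fun j => PowerSeries.C (a i e j) := by
    change Matrix.det _ = Matrix.det _
    congr 1
    ext1 i j
    simp [Finset.sum_apply]
  have hterm (ε : ι → ℕ) :
      D (fun i => (PowerSeries.X ^ ε i : PowerSeries R) • fun j => PowerSeries.C (a i (ε i) j)) =
        PowerSeries.X ^ (∑ i, ε i) * PowerSeries.C (Matrix.of fun i => a i (ε i)).det := by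
    rw [D.map_smul_univ, Finset.prod_pow_eq_pow_sum, smul_eq_mul, RingHom.map_det]
    rfl
  have hset : Fintype.piFinset (fun i => Finset.range (m i + 1)) = Finset.Iic m := by
    ext ε
    simp [Fintype.mem_piFinset, Pi.le_def]
  rw [hrows, D.map_sum_finset, hset, map_sum, Finset.sum_filter]
  simp only [hterm, PowerSeries.coeff_mul_C, PowerSeries.coeff_X_pow, ite_mul, one_mul, zero_mul,
    eq_comm]

theorem one_sub_mul_sum_X_pow_zpow {K : Type*} [Field K] {a : K} (ha : a ≠ 0) (l : ℤ) (n : ℕ) :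
    (1 - PowerSeries.C a⁻¹ * PowerSeries.X) *
      ∑ e ∈ Finset.range n, PowerSeries.X ^ e * PowerSeries.C (a ^ (l - e)) =
    PowerSeries.C (a ^ l) - PowerSeries.X ^ n * PowerSeries.C (a ^ (l - n)) := by
  have hterm (e : ℕ) : PowerSeries.X ^ e * PowerSeries.C (a ^ (l - e)) =
      PowerSeries.C (a ^ l) * (PowerSeries.C a⁻¹ * PowerSeries.X) ^ e := by
    rw [zpow_sub₀ ha, zpow_natCast, div_eq_mul_inv, ← inv_pow, map_mul, map_pow]
    ring
  simp only [hterm]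
  rw [← Finset.mul_sum, mul_left_comm, mul_neg_geom_sum, mul_sub, mul_one]

-- The moved particles go around a circle: past the last particle comes the first one, up to `κ`.
theorem zpow_pos_sub_eq {K : Type*} [Field K] {N k : ℕ} {y : Fin (N + 1) → K}
    (hy0 : ∀ j, y j ≠ 0) {κ : K} (hκ : ∀ j, y j ^ (k + (N + 1)) = κ) (m : Weight N k)
    (i j : Fin (N + 1)) :
    y j ^ (pos m.1 i - (m.1 i + 1 : ℕ)) =
      (if i = Fin.last N then κ⁻¹ else 1) * y j ^ pos m.1 (i + 1) := by
  induction i using Fin.lastCases with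
  | last =>
    simp only [if_true, Fin.last_add_one, pos_zero, pos_last, m.2]
    rw [← hκ j, ← zpow_natCast, ← zpow_neg, ← zpow_add₀ (hy0 j)]
    congr 1
    push_cast
    ring
  | cast i =>
    simp only [Fin.coeSucc_eq_succ, pos_castSucc, i.castSucc_ne_last, if_false, one_mul]
    congr 1
    push_cast
    ring

theorem exists_det_geom_eq_hSeries_mul {N k : ℕ} {y : Fin (N + 1) → ℂ} (hy0 : ∀ j, y j ≠ 0)
    {κ : ℂ} (hκ : ∀ j, y j ^ (k + (N + 1)) = κ) (m : Weight N k) :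
    ∃ Z, (Matrix.of fun i j => ∑ e ∈ Finset.range (m.1 i + 1),
      PowerSeries.X ^ e * PowerSeries.C (y j ^ (pos m.1 i - e))).det =
      hSeries y⁻¹ * (PowerSeries.C (slater y (pos m.1)) + PowerSeries.X ^ (k + (N + 1)) * Z) := by
  set a : Fin (N + 1) → Fin (N + 1) → PowerSeries ℂ := fun i j => PowerSeries.C (y j ^ pos m.1 i)
  set b : Fin (N + 1) → Fin (N + 1) → PowerSeries ℂ := fun i j =>
    PowerSeries.C (y j ^ (pos m.1 i - (m.1 i + 1 : ℕ)))
  have hb (i) : b i = (if i = Fin.last N then PowerSeries.C κ⁻¹ else 1) • a (i + 1) := by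
    funext j
    simp only [a, b, Pi.smul_apply, smul_eq_mul, zpow_pos_sub_eq hy0 hκ m i j, map_mul,
      apply_ite PowerSeries.C, map_one]
  have hsum : ∑ i, (m.1 i + 1) = k + (N + 1) := by simp [Finset.sum_add_distrib, m.2]
  refine ⟨(-1) ^ (N + 1) * (Matrix.of b).det, ?_⟩
  have hslater : (Matrix.of a).det = PowerSeries.C (slater y (pos m.1)) := by
    rw [slater, RingHom.map_det]
    rfl
  have hcyclic := det_sub_cyclic (fun i => PowerSeries.X ^ (m.1 i + 1)) a b _ hb
  rw [Finset.prod_neg, Finset.prod_pow_eq_pow_sum, hsum, hslater, Finset.card_univ,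
    Fintype.card_fin] at hcyclic
  have hgeom : (∏ j, (1 - PowerSeries.C (y⁻¹ j) * PowerSeries.X)) *
      (Matrix.of fun i j => ∑ e ∈ Finset.range (m.1 i + 1),
        PowerSeries.X ^ e * PowerSeries.C (y j ^ (pos m.1 i - e))).det =
      (Matrix.of fun i => a i - (PowerSeries.X : PowerSeries ℂ) ^ (m.1 i + 1) • b i).det := by
    rw [← Matrix.det_mul_row]
    congr 1
    ext1 i j
    rw [Matrix.of_apply, Matrix.of_apply, Pi.inv_apply, one_sub_mul_sum_X_pow_zpow (hy0 j)]
    rfl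
  linear_combination (hSeries y⁻¹) * (hgeom.trans hcyclic) -
    (Matrix.of fun i j => ∑ e ∈ Finset.range (m.1 i + 1),
      PowerSeries.X ^ e * PowerSeries.C (y j ^ (pos m.1 i - e))).det * prod_one_sub_mul_hSeries y⁻¹

theorem sum_slater_sub {N k : ℕ} {y : Fin (N + 1) → ℂ} (hy0 : ∀ j, y j ≠ 0) {κ : ℂ}
    (hκ : ∀ j, y j ^ (k + (N + 1)) = κ) {r : ℕ} (hr : r < k + (N + 1)) (m : Weight N k) :
    ∑ ε ∈ Finset.Iic m.1 with ∑ i, ε i = r, slater y (fun i => pos m.1 i - ε i) =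
      complete y⁻¹ r * slater y (pos m.1) := by
  obtain ⟨Z, hZ⟩ := exists_det_geom_eq_hSeries_mul hy0 hκ m
  have hcoeff := coeff_det_sum_X_pow m.1 (fun i e j => y j ^ (pos m.1 i - e)) r
  rw [hZ, mul_add, map_add, PowerSeries.coeff_mul_C, mul_left_comm,
    PowerSeries.coeff_X_pow_mul', if_neg (by omega), add_zero] at hcoeff
  rw [complete, intCoeff_natCast, hcoeff]
  rfl

theorem wave_apply {N k : ℕ} (y : Fin (N + 1) → ℂ) (m : Weight N k) :
    wave k y m.1 = slater y (pos m.1) :=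
  toState_val _ m

theorem wave_apply_of_ne {N k : ℕ} (y : Fin (N + 1) → ℂ) {m : Fin (N + 1) → ℕ}
    (h : ∑ i, m i ≠ k) : wave k y m = 0 := by
  rw [wave, levelVec_apply, if_neg h]

theorem hOp_wave {N k : ℕ} {y : Fin (N + 1) → ℂ} (hy : ∏ j, y j = 1) {κ : ℂ}
    (hκ : ∀ j, y j ^ (k + (N + 1)) = κ) {r : ℕ} (hr : r < k + (N + 1)) :
    hOp 1 r (wave k y) = complete y⁻¹ r • wave k y := by
  ext m
  rw [hOp_apply, Finsupp.smul_apply, smul_eq_mul]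
  by_cases hm : ∑ i, m i = k
  · lift m to Weight N k using hm
    rw [wave_apply, ← sum_slater_sub (ne_zero_of_prod_eq_one hy) hκ hr m]
    refine Finset.sum_congr rfl fun ε hε => ?_
    have hle := Finset.mem_Iic.mp (Finset.mem_filter.mp hε).1
    rw [← slater_add_const hy _ (ε 0), ← pos_moved hle]
    exact wave_apply y ⟨_, (sum_moved hle).trans m.2⟩
  · rw [wave_apply_of_ne y hm, mul_zero]
    refine Finset.sum_eq_zero fun ε hε => wave_apply_of_ne y ?_
    rwa [sum_moved (Finset.mem_Iic.mp (Finset.mem_filter.mp hε).1)]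

theorem hOp_wave_of_lt {N k : ℕ} (y : Fin (N + 1) → ℂ) {r : ℕ} (hr : k < r) :
    hOp 1 r (wave k y) = 0 := by
  ext m
  rw [hOp_apply, Finsupp.zero_apply]
  refine Finset.sum_eq_zero fun ε hε => wave_apply_of_ne y ?_
  obtain ⟨hle, hsum⟩ := Finset.mem_filter.mp hε
  rw [Finset.mem_Iic] at hle
  rw [sum_moved hle]
  exact (hr.trans_le (hsum ▸ Finset.sum_le_sum fun i _ => hle i)).ne'

theorem exists_hOp_wave {N k : ℕ} {y : Fin (N + 1) → ℂ} (hy : ∏ j, y j = 1) {κ : ℂ}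
    (hκ : ∀ j, y j ^ (k + (N + 1)) = κ) (r : ℕ) :
    ∃ a : ℂ, hOp 1 r (wave k y) = a • wave k y := by
  obtain h | h := le_or_gt r k
  · exact ⟨_, hOp_wave hy hκ (by omega)⟩
  · exact ⟨0, by rw [hOp_wave_of_lt y h, zero_smul]⟩

theorem list_prod_apply_of_eigen {R V : Type*} [CommSemiring R] [AddCommMonoid V] [Module R V]
    {n : ℕ} (X : Fin n → Module.End R V) (a : Fin n → R) {v : V} (h : ∀ i, X i v = a i • v) :
    (List.ofFn X).prod v = (∏ i, a i) • v := by
  induction n with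
  | zero => simp
  | succ n ih =>
    rw [List.ofFn_succ, List.prod_cons, Module.End.mul_apply,
      ih (fun i => X i.succ) (fun i => a i.succ) fun i => h i.succ, map_smul, h, smul_smul,
      Fin.prod_univ_succ, mul_comm]

theorem part_le {N k : ℕ} (l : Weight N k) (i : Fin (N + 1)) : part l.1 i ≤ k :=
  calc part l.1 i ≤ ∑ j, l.1 j := Finset.sum_le_sum_of_subset (Finset.filter_subset _ _)
    _ = k := l.2

theorem pos_eq_part {N : ℕ} (m : Fin (N + 1) → ℕ) (i : Fin (N + 1)) :
    pos m i = part m i + m (Fin.last N) + (N - i) := by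
  have herase : ({j | i ≤ j ∧ j ≠ Fin.last N} : Finset (Fin (N + 1))) =
      Finset.erase {j | i ≤ j} (Fin.last N) := by
    ext j
    simp [and_comm]
  rw [pos, part, herase, ← Nat.cast_add, Finset.sum_erase_add _ _ (by simp [Fin.le_last]),
    Nat.cast_sum]

theorem part_last {N : ℕ} (m : Fin (N + 1) → ℕ) : part m (Fin.last N) = 0 := by
  have h := pos_eq_part m (Fin.last N)
  rw [pos_last, Fin.val_last] at h
  omega

/-- The value at `y` of the Schur polynomial of the partition of `m`, by the Jacobi–Trudi
determinant of complete symmetric polynomials. -/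
def schur {R : Type*} [CommRing R] {N : ℕ} (y : Fin (N + 1) → R) (m : Fin (N + 1) → ℕ) : R :=
  (Matrix.of fun i j : Fin (N + 1) => complete y (part m i - i + j)).det

theorem schur_mul_slater {K : Type*} [Field K] {N : ℕ} {y : Fin (N + 1) → K}
    (hy : ∏ j, y j = 1) (m : Fin (N + 1) → ℕ) :
    schur y m * slater y (fun i => N - i) = slater y (pos m) := by
  have hpos : pos m = fun i => ((part m i : ℤ) + (N - i)) + m (Fin.last N) := by
    funext i
    rw [pos_eq_part]
    ring
  rw [hpos, slater_add_const hy, schur,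
    ← det_complete_mul_slater y (l := fun i => (part m i : ℤ) + (N - i)) fun i => by omega]
  congr 3
  funext i j
  congr 1
  ring

theorem sum_perm_complete {R : Type*} [CommRing R] {N k : ℕ} (y : Fin (N + 1) → R)
    (l : Weight N k) :
    ∑ w : Equiv.Perm (Fin N), (Equiv.Perm.sign w : ℤ) •
      ∏ i : Fin N, complete y ((l.toPart i : ℤ) - i + w i) = schur y l.1 := by
  have hdet : ∑ w : Equiv.Perm (Fin N), (Equiv.Perm.sign w : ℤ) •
      ∏ i : Fin N, complete y ((l.toPart i : ℤ) - i + w i) =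
      (Matrix.of fun i j : Fin N => complete y ((l.toPart i : ℤ) - i + j)).det := by
    rw [← Matrix.det_transpose, Matrix.det_apply]
    rfl
  rw [hdet, schur, Matrix.det_succ_row _ (Fin.last N), Finset.sum_eq_single (Fin.last N)]
  · rw [Matrix.of_apply, part_last, Nat.cast_zero, zero_sub, neg_add_cancel, complete_zero,
      ← two_mul, pow_mul, neg_one_sq, one_pow, one_mul, one_mul]
    congr 1
    ext i j
    simp [Weight.toPart, Fin.succAbove_last]
  · intro j _ hj
    have hlt : (j : ℕ) < N := Fin.val_lt_last hj
    rw [Matrix.of_apply, part_last, complete_of_neg _ (by rw [Fin.val_last]; omega), mul_zero,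
      zero_mul]
  · simp

theorem schurOp_wave {N k : ℕ} {y : Fin (N + 1) → ℂ} (hy : ∏ j, y j = 1) {κ : ℂ}
    (hκ : ∀ j, y j ^ (k + (N + 1)) = κ) (l : Weight N k) :
    schurOp 1 l.toPart (wave k y) = schur y⁻¹ l.1 • wave k y := by
  rw [← sum_perm_complete, schurOp, LinearMap.sum_apply, Finset.sum_smul]
  refine Finset.sum_congr rfl fun w _ => ?_
  rw [LinearMap.smul_apply, smul_assoc, list_prod_apply_of_eigen _
    (fun i : Fin N => complete y⁻¹ ((l.toPart i : ℤ) - i + w i))]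
  intro i
  have hpart : l.toPart i ≤ k := part_le l _
  have hw := (w i).2
  rw [hOpInt]
  split_ifs with h
  · rw [hOp_wave hy hκ (by omega), Int.toNat_of_nonneg h]
  · rw [complete_of_neg _ (by omega), zero_smul, LinearMap.zero_apply]

/-! ## The momenta of a weight -/

theorem sum_rhoShift {N : ℕ} (m : Fin (N + 1) → ℕ) : ∑ i, rhoShift m i = 0 := by
  have hsum : (∑ i : Fin (N + 1), ((i : ℕ) : ℝ)) * 2 = (N + 1) * N := by
    rw [Fin.sum_univ_eq_sum_range (fun i => (i : ℝ))]
    have hgauss := congrArg (Nat.cast : ℕ → ℝ) (Finset.sum_range_id_mul_two (N + 1))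
    rw [Nat.add_sub_cancel] at hgauss
    push_cast at hgauss
    exact hgauss
  have hsize : ∑ i : Fin (N + 1), (part m i : ℝ) = size m := by
    rw [size, Nat.cast_sum]
  simp only [rhoShift, Finset.sum_add_distrib, Finset.sum_sub_distrib, Finset.sum_const,
    Finset.card_univ, Fintype.card_fin, nsmul_eq_mul, hsize]
  push_cast
  field_simp
  linarith

/-- The shift between the positions `pos m` and the coordinates of `λ + ρ`. -/
def rhoConst {N : ℕ} (m : Fin (N + 1) → ℕ) : ℝ :=
  m (Fin.last N) + (size m : ℝ) / (N + 1) + (N : ℝ) / 2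

theorem rhoShift_eq {N : ℕ} (m : Fin (N + 1) → ℕ) (i : Fin (N + 1)) :
    rhoShift m i = pos m i - rhoConst m := by
  rw [pos_eq_part, rhoShift, rhoConst]
  push_cast
  ring

theorem rhoShift_sub {N : ℕ} (m : Fin (N + 1) → ℕ) (i j : Fin (N + 1)) :
    rhoShift m i - rhoShift m j = (pos m i - pos m j : ℤ) := by
  rw [rhoShift_eq, rhoShift_eq]
  push_cast
  ring

theorem pos_le {N : ℕ} (m : Fin (N + 1) → ℕ) (i : Fin (N + 1)) :
    pos m i ≤ (∑ j, m j : ℕ) + (N - i) := by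
  rw [pos, ← Nat.cast_sum]
  gcongr
  exact Finset.filter_subset _ _

theorem pos_nonneg {N : ℕ} (m : Fin (N + 1) → ℕ) (i : Fin (N + 1)) : 0 ≤ pos m i := by
  rw [pos_eq_part]
  omega

theorem pos_strictAnti {N : ℕ} (m : Fin (N + 1) → ℕ) : StrictAnti (pos m) :=
  Fin.strictAnti_iff_succ_lt.mpr fun i => by
    rw [pos_castSucc]; omega

theorem rhoShift_strictAnti {N : ℕ} (m : Fin (N + 1) → ℕ) : StrictAnti (rhoShift m) := by
  intro i j hij
  rw [← sub_pos, rhoShift_sub, Int.cast_pos, sub_pos]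
  exact pos_strictAnti m hij

theorem rhoShift_sub_lt {N k : ℕ} (s : Weight N k) (i j : Fin (N + 1)) :
    rhoShift s.1 i - rhoShift s.1 j < k + (N + 1) := by
  have hle := pos_le s.1 i
  have hnonneg := pos_nonneg s.1 j
  rw [s.2] at hle
  rw [rhoShift_sub]
  exact_mod_cast (by omega : pos s.1 i - pos s.1 j < k + (N + 1))

theorem eq_of_rhoShift_eq {N k : ℕ} {s t : Weight N k} (h : rhoShift s.1 = rhoShift t.1) :
    s = t := by
  have hcast (i : Fin N) : s.1 i.castSucc = t.1 i.castSucc := by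
    have hsub := rhoShift_sub s.1 i.castSucc i.succ
    rw [h, rhoShift_sub, Int.cast_inj, pos_castSucc, pos_castSucc] at hsub
    omega
  have hs := s.2
  have ht := t.2
  rw [Fin.sum_univ_castSucc] at hs ht
  simp only [hcast] at hs
  refine Subtype.ext (funext fun i => ?_)
  induction i using Fin.lastCases with
  | last => omega
  | cast i => exact hcast i

/-- The primitive root of unity `ζ = exp (2πi / (k + n))`. -/
def zeta (N k : ℕ) : ℂ := Complex.exp (2 * Real.pi * Complex.I / ((k : ℂ) + (N + 1)))

theorem isPrimitiveRoot_zeta (N k : ℕ) : IsPrimitiveRoot (zeta N k) (k + (N + 1)) := by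
  have := Complex.isPrimitiveRoot_exp (k + (N + 1)) (by omega)
  push_cast at this
  exact this

theorem level_add_rank_ne_zero (N k : ℕ) : (k : ℂ) + (N + 1) ≠ 0 := by
  exact_mod_cast (by omega : k + (N + 1) ≠ 0)

/-- The powers of `ζ` whose exponents are the coordinates of `σ + ρ`: the parameters of the wave
that the weight `σ` contributes to the diagonalisation. -/
def weightRoot {N k : ℕ} (s : Weight N k) (j : Fin (N + 1)) : ℂ :=
  Complex.exp (2 * Real.pi * Complex.I / ((k : ℂ) + (N + 1)) * (rhoShift s.1 j : ℝ))

/-- The common phase by which the roots of a weight differ from integral powers of `ζ`. -/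
def rootPhase {N k : ℕ} (s : Weight N k) : ℂ :=
  Complex.exp (2 * Real.pi * Complex.I / ((k : ℂ) + (N + 1)) *
    ((s.1 (Fin.last N) : ℂ) - (rhoConst s.1 : ℝ)))

theorem weightRoot_eq {N k : ℕ} (s : Weight N k) (j : Fin (N + 1)) :
    weightRoot s j = zeta N k ^ (part s.1 j + (N - j)) * rootPhase s := by
  have hj : (j : ℕ) ≤ N := Nat.lt_succ_iff.mp j.2
  rw [weightRoot, rhoShift_eq, pos_eq_part, zeta, rootPhase, ← Complex.exp_nat_mul,
    ← Complex.exp_add]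
  congr 1
  push_cast [Nat.cast_sub hj]
  ring

theorem prod_weightRoot {N k : ℕ} (s : Weight N k) : ∏ j, weightRoot s j = 1 := by
  simp only [weightRoot]
  rw [← Complex.exp_sum, ← Finset.mul_sum, ← Complex.ofReal_sum, sum_rhoShift,
    Complex.ofReal_zero, mul_zero, Complex.exp_zero]

theorem weightRoot_pow {N k : ℕ} (s : Weight N k) (j : Fin (N + 1)) :
    weightRoot s j ^ (k + (N + 1)) = rootPhase s ^ (k + (N + 1)) := by
  rw [weightRoot_eq, mul_pow, ← pow_mul, mul_comm, pow_mul',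
    (isPrimitiveRoot_zeta N k).pow_eq_one, one_pow, mul_one]

theorem prod_weightRoot_inv {N k : ℕ} (s : Weight N k) : ∏ j, (weightRoot s)⁻¹ j = 1 := by
  simp only [Pi.inv_apply]
  rw [Finset.prod_inv_distrib, prod_weightRoot, inv_one]

theorem exists_int_of_weightRoot_eq {N k : ℕ} {s t : Weight N k} {i j : Fin (N + 1)}
    (h : weightRoot s i = weightRoot t j) :
    ∃ c : ℤ, rhoShift s.1 i = rhoShift t.1 j + c * (k + (N + 1)) := by
  rw [weightRoot, weightRoot, Complex.exp_eq_exp_iff_exists_int] at h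
  obtain ⟨c, hc⟩ := h
  refine ⟨c, ?_⟩
  have hK := level_add_rank_ne_zero N k
  suffices h : ((rhoShift s.1 i : ℝ) : ℂ) = ((rhoShift t.1 j + c * (k + (N + 1)) : ℝ) : ℂ) by
    exact_mod_cast h
  push_cast
  apply mul_left_cancel₀ (div_ne_zero Complex.two_pi_I_ne_zero hK)
  rw [hc]
  field_simp

theorem weightRoot_injective {N k : ℕ} (s : Weight N k) : Function.Injective (weightRoot s) := by
  intro i j h
  obtain ⟨c, hc⟩ := exists_int_of_weightRoot_eq h
  have hij := rhoShift_sub_lt s i j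
  have hji := rhoShift_sub_lt s j i
  have : (0 : ℝ) < k + (N + 1) := by positivity
  have hlt : c < 1 := by
    have : (c : ℝ) < 1 := by nlinarith
    exact_mod_cast this
  have hgt : -1 < c := by
    have : (-1 : ℝ) < c := by nlinarith
    exact_mod_cast this
  obtain rfl : c = 0 := by omega
  exact (rhoShift_strictAnti s.1).injective (by simpa using hc)

theorem eq_zero_of_sum_eq_zero_of_le_add_one {ι : Type*} [Fintype ι] {c : ι → ℤ}
    (hsum : ∑ j, c j = 0) (hle : ∀ i j, c i ≤ c j + 1) : c = 0 := by
  by_contra hne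
  obtain ⟨i, hi⟩ := Function.ne_iff.mp hne
  rcases lt_or_gt_of_ne hi with hlt | hgt
  · exact hsum.not_lt (Finset.sum_neg' (fun j _ => by have := hle j i; simp at hlt; omega)
      ⟨i, Finset.mem_univ i, hlt⟩)
  · exact hsum.not_gt (Finset.sum_pos' (fun j _ => by have := hle i j; simp at hgt; omega)
      ⟨i, Finset.mem_univ i, hgt⟩)

theorem eq_of_weightRoot_mem_range {N k : ℕ} {s t : Weight N k}
    (h : ∀ j, weightRoot s j ∈ Set.range (weightRoot t)) : s = t := by
  choose p hp using h
  have hp_inj : Function.Injective p := fun i j hij =>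
    weightRoot_injective s (by rw [← hp, ← hp, hij])
  set e := Equiv.ofBijective p (Finite.injective_iff_bijective.mp hp_inj)
  replace h (j) : weightRoot s j = weightRoot t (e j) := (hp j).symm
  choose c hc using fun j => exists_int_of_weightRoot_eq (h j)
  have hK : (0 : ℝ) < k + (N + 1) := by positivity
  have hsum : ∑ j, c j = 0 := by
    have hrho := sum_rhoShift s.1
    simp only [hc] at hrho
    rw [Finset.sum_add_distrib, Equiv.sum_comp e (rhoShift t.1), sum_rhoShift, zero_add,
      ← Finset.sum_mul] at hrho
    exact_mod_cast (mul_eq_zero.mp hrho).resolve_right hK.ne'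
  have hle (i j) : c i ≤ c j + 1 := by
    have hs := rhoShift_sub_lt s i j
    have ht := rhoShift_sub_lt t (e j) (e i)
    rw [hc i, hc j] at hs
    have hlt : (c i : ℝ) < c j + 2 := by nlinarith
    have : c i < c j + 2 := by exact_mod_cast hlt
    omega
  have hperm : rhoShift s.1 = rhoShift t.1 ∘ e := by
    funext j
    simp [hc j, eq_zero_of_sum_eq_zero_of_le_add_one hsum hle]
  refine eq_of_rhoShift_eq (((rhoShift_strictAnti s.1).range_inj
    (rhoShift_strictAnti t.1)).mp ?_)
  rw [hperm, e.surjective.range_comp]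

theorem slater_rev_ne_zero {K : Type*} [Field K] {N : ℕ} {y : Fin (N + 1) → K}
    (hy : Function.Injective y) : slater y (fun i => N - i) ≠ 0 := by
  have hrev : (Matrix.of fun i j : Fin (N + 1) => y j ^ ((N : ℤ) - i)) =
      (Matrix.vandermonde y).transpose.submatrix Fin.revPerm id := by
    ext i j
    simp only [Matrix.of_apply, Matrix.submatrix_apply, Matrix.transpose_apply,
      Matrix.vandermonde_apply, Fin.revPerm_apply, Fin.val_rev, id, ← zpow_natCast]
    congr 1
    omega
  rw [slater, hrev, Matrix.det_permute, Matrix.det_transpose]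
  refine mul_ne_zero ?_ (Matrix.det_vandermonde_ne_zero_iff.mpr hy)
  obtain h | h := Int.units_eq_one_or (Equiv.Perm.sign (Fin.revPerm (n := N + 1))) <;> simp [h]

/-! ## Orthogonality of the waves -/

theorem prod_one_sub_eq_of_complete_eq {R : Type*} [CommRing R] {N : ℕ} {y z : Fin (N + 1) → R}
    (hprod : ∏ j, y j = ∏ j, z j) (h : ∀ r : ℕ, r ≤ N → complete y r = complete z r) :
    ∏ j, (1 - Polynomial.C (y j) * Polynomial.X) =
      ∏ j, (1 - Polynomial.C (z j) * Polynomial.X) := by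
  have hcoe (y : Fin (N + 1) → R) :
      ((∏ j, (1 - Polynomial.C (y j) * Polynomial.X) : Polynomial R) : PowerSeries R) =
        ∏ j, (1 - PowerSeries.C (y j) * PowerSeries.X) := by
    rw [← Polynomial.coeToPowerSeries.ringHom_apply, map_prod]
    simp
  have hdvd : PowerSeries.X ^ (N + 1) ∣ hSeries z - hSeries y :=
    PowerSeries.X_pow_dvd_iff.mpr fun r hr => by
      have := h r (by omega)
      rw [complete, complete, intCoeff_natCast] at this
      rw [map_sub, this, sub_self]
  have hdiff := hdvd.mul_left ((∏ j, (1 - PowerSeries.C (y j) * PowerSeries.X)) *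
    ∏ j, (1 - PowerSeries.C (z j) * PowerSeries.X))
  rw [mul_sub, mul_assoc, prod_one_sub_mul_hSeries, mul_one, mul_right_comm,
    prod_one_sub_mul_hSeries, one_mul, ← hcoe, ← hcoe, PowerSeries.X_pow_dvd_iff] at hdiff
  have hdeg (a : R) : (1 - Polynomial.C a * Polynomial.X).natDegree ≤ 1 := by compute_degree
  have hlead (y : Fin (N + 1) → R) :
      (∏ j, (1 - Polynomial.C (y j) * Polynomial.X)).coeff (N + 1) =
        (-1) ^ (N + 1) * ∏ j, y j := by
    have := Polynomial.coeff_prod_of_natDegree_le (s := Finset.univ) _ _ fun j _ => hdeg (y j)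
    simpa [Polynomial.coeff_one, Finset.prod_neg] using this
  rw [Polynomial.ext_iff_natDegree_le (n := N + 1)]
  · intro d hd
    obtain h | rfl := Nat.lt_or_eq_of_le hd
    · simpa [sub_eq_zero] using hdiff d h
    · rw [hlead, hlead, hprod]
  all_goals
    refine (Polynomial.natDegree_prod_le _ _).trans
      ((Finset.sum_le_card_nsmul _ _ 1 fun q _ => hdeg _).trans ?_)
    simp

theorem mem_range_of_complete_inv_eq {K : Type*} [Field K] {N : ℕ} {y z : Fin (N + 1) → K}
    (hy : ∏ j, y j = 1) (hz : ∏ j, z j = 1)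
    (h : ∀ r : ℕ, r ≤ N → complete y⁻¹ r = complete z⁻¹ r) (j : Fin (N + 1)) :
    y j ∈ Set.range z := by
  have hprod : ∏ j, y⁻¹ j = ∏ j, z⁻¹ j := by
    simp only [Pi.inv_apply, Finset.prod_inv_distrib, hy, hz]
  have heval := congrArg (Polynomial.eval (y j)) (prod_one_sub_eq_of_complete_eq hprod h)
  simp only [Polynomial.eval_prod, Polynomial.eval_sub, Polynomial.eval_one, Polynomial.eval_mul,
    Polynomial.eval_C, Polynomial.eval_X, Pi.inv_apply] at heval
  rw [Finset.prod_eq_zero (Finset.mem_univ j)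
    (by rw [inv_mul_cancel₀ (ne_zero_of_prod_eq_one hy j), sub_self]), eq_comm,
    Finset.prod_eq_zero_iff] at heval
  obtain ⟨i, -, hi⟩ := heval
  exact ⟨i, (eq_of_inv_mul_eq_one (sub_eq_zero.mp hi).symm)⟩

theorem sum_sum_filter_Iic {M : Type*} [AddCommMonoid M] {N k q r : ℕ} (hk : q + r = k)
    (F : (Fin (N + 1) → ℕ) → (Fin (N + 1) → ℕ) → M) :
    ∑ m : Weight N k, ∑ ε ∈ Finset.Iic m.1 with ∑ i, ε i = r, F (m.1 - ε) ε =
      ∑ a : Weight N q, ∑ b : Weight N r, F a.1 b.1 := by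
  subst hk
  rw [Finset.sum_sigma', ← Fintype.sum_prod_type']
  refine Finset.sum_bij' (fun x hx => (⟨x.1.1 - x.2, ?_⟩, ⟨x.2, ?_⟩))
    (fun p _ => ⟨⟨p.1.1 + p.2.1, ?_⟩, p.2.1⟩) ?_ ?_ ?_ ?_ ?_
  · simp only [Finset.mem_sigma, Finset.mem_univ, true_and, Finset.mem_filter,
      Finset.mem_Iic] at hx
    simp only [Pi.sub_apply]
    rw [Finset.sum_tsub_distrib _ fun i _ => hx.1 i, hx.2, x.1.2, Nat.add_sub_cancel]
  · simp only [Finset.mem_sigma, Finset.mem_univ, true_and, Finset.mem_filter] at hx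
    exact hx.2
  · simp only [Pi.add_apply, Finset.sum_add_distrib, p.1.2, p.2.2]
  · simp
  · intro p _
    simpa using p.2.2
  · rintro ⟨m, ε⟩ hx
    simp only [Finset.mem_sigma, Finset.mem_univ, true_and, Finset.mem_filter,
      Finset.mem_Iic] at hx
    congr
    exact tsub_add_cancel_of_le hx.1
  · simp
  · simp

theorem hOp_level_apply {N k : ℕ} (f : State N) (m : Weight N k) :
    hOp 1 k f m.1 = f fun i => m.1 (i + 1) := by
  rw [hOp_apply, Finset.sum_eq_single m.1]
  · congr 1
    funext i
    simp [moved]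
  · intro ε hε hne
    simp only [Finset.mem_filter, Finset.mem_Iic] at hε
    refine absurd (funext fun i => ?_) hne
    exact (Finset.sum_eq_sum_iff_of_le fun i _ => hε.1 i).mp (hε.2.trans m.2.symm) i
      (Finset.mem_univ i)
  · simp [m.2]

-- Both sides sum `f (a + b ∘ (· + 1)) * g ((a + b) ∘ (· + 1))` over `|a| = q` and `|b| = r`.
theorem sum_hOp_mul_hOp {N k q r : ℕ} (hk : q + r = k) (f g : State N) :
    ∑ m : Weight N k, hOp 1 r f m.1 * hOp 1 k g m.1 =
      ∑ m : Weight N k, f m.1 * hOp 1 q g m.1 := by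
  have hleft := sum_sum_filter_Iic (N := N) hk
    fun a b => f (fun i => a i + b (i + 1)) * g fun i => a (i + 1) + b (i + 1)
  have hright := sum_sum_filter_Iic (N := N) ((add_comm r q).trans hk)
    fun b a => f (b + a) * g fun i => b i + a (i + 1)
  let rotate : Weight N r ≃ Weight N r :=
    ((Equiv.addRight (1 : Fin (N + 1))).arrowCongr (Equiv.refl ℕ)).symm.subtypeEquiv fun b => by
      rw [← Equiv.sum_comp (Equiv.addRight 1) b]
      rfl
  calc ∑ m : Weight N k, hOp 1 r f m.1 * hOp 1 k g m.1
      = ∑ a : Weight N q, ∑ b : Weight N r,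
          f (fun i => a.1 i + b.1 (i + 1)) * g fun i => a.1 (i + 1) + b.1 (i + 1) := by
        rw [← hleft]
        refine Finset.sum_congr rfl fun m _ => ?_
        rw [hOp_level_apply, hOp_apply, Finset.sum_mul]
        refine Finset.sum_congr rfl fun ε hε => ?_
        have hle := Finset.mem_Iic.mp (Finset.mem_filter.mp hε).1
        simp only [Pi.sub_apply, tsub_add_cancel_of_le (hle _)]
        rfl
    _ = ∑ b : Weight N r, ∑ a : Weight N q, f (b.1 + a.1) * g fun i => b.1 i + a.1 (i + 1) := by
        rw [Finset.sum_comm]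
        conv_rhs => rw [← Equiv.sum_comp rotate]
        refine Finset.sum_congr rfl fun b _ => Finset.sum_congr rfl fun a _ => ?_
        congr 2 <;> funext i <;> exact add_comm _ _
    _ = ∑ m : Weight N k, f m.1 * hOp 1 q g m.1 := by
        rw [← hright]
        refine Finset.sum_congr rfl fun m _ => ?_
        rw [hOp_apply, Finset.mul_sum]
        refine Finset.sum_congr rfl fun ε hε => ?_
        rw [tsub_add_cancel_of_le (Finset.mem_Iic.mp (Finset.mem_filter.mp hε).1)]
        rfl

-- The relation is `H_r(y⁻¹) H_k(z⁻¹) = H_{k - r}(z⁻¹)`; at `r = k` it shows that `H_k(z⁻¹) ≠ 0`.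
theorem complete_inv_eq_of_sum_ne_zero {N k : ℕ} {x y z : Fin (N + 1) → ℂ} {κ μ ν : ℂ}
    (hx : ∏ j, x j = 1) (hκ : ∀ j, x j ^ (k + (N + 1)) = κ)
    (hy : ∏ j, y j = 1) (hμ : ∀ j, y j ^ (k + (N + 1)) = μ)
    (hz : ∏ j, z j = 1) (hν : ∀ j, z j ^ (k + (N + 1)) = ν)
    (hxz : ∑ m : Weight N k, wave k x m.1 * wave k z m.1 ≠ 0)
    (hyz : ∑ m : Weight N k, wave k y m.1 * wave k z m.1 ≠ 0)
    {r : ℕ} (hr : r < k + (N + 1)) : complete x⁻¹ r = complete y⁻¹ r := by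
  have hrel {w : Fin (N + 1) → ℂ} {c : ℂ} (hw : ∏ j, w j = 1)
      (hc : ∀ j, w j ^ (k + (N + 1)) = c)
      (hwz : ∑ m : Weight N k, wave k w m.1 * wave k z m.1 ≠ 0) {q r : ℕ} (hqr : q + r = k) :
      complete w⁻¹ r * complete z⁻¹ k = complete z⁻¹ q := by
    have hsum := sum_hOp_mul_hOp hqr (wave k w) (wave k z)
    rw [hOp_wave hw hc (by omega), hOp_wave hz hν (by omega), hOp_wave hz hν (by omega)] at hsum
    simp only [Finsupp.smul_apply, smul_eq_mul, mul_mul_mul_comm _ (wave k w _),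
      mul_left_comm (wave k w _), ← Finset.mul_sum] at hsum
    exact mul_right_cancel₀ hwz hsum
  obtain h | h := le_or_gt r k
  · have hk0 : complete z⁻¹ k ≠ 0 := by
      refine right_ne_zero_of_mul (a := complete x⁻¹ k) ?_
      rw [hrel hx hκ hxz (zero_add k), Nat.cast_zero, complete_zero]
      exact one_ne_zero
    have hqr := Nat.sub_add_cancel h
    exact mul_right_cancel₀ hk0 ((hrel hx hκ hxz hqr).trans (hrel hy hμ hyz hqr).symm)
  · have hvanish {w : Fin (N + 1) → ℂ} {c : ℂ} (hw : ∏ j, w j = 1)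
        (hc : ∀ j, w j ^ (k + (N + 1)) = c)
        (hwz : ∑ m : Weight N k, wave k w m.1 * wave k z m.1 ≠ 0) : complete w⁻¹ r = 0 := by
      have hwave := (hOp_wave hw hc hr).symm.trans (hOp_wave_of_lt w h)
      refine (smul_eq_zero.mp hwave).resolve_right fun h0 => hwz ?_
      simp [h0]
    rw [hvanish hx hκ hxz, hvanish hy hμ hyz]

theorem inn_toState {N k : ℕ} (f g : Weight N k → ℂ) :
    inn (toState f) (toState g) = ∑ m, (starRingEnd ℂ) (f m) * g m := by
  rw [inn, Finsupp.sum_of_support_subset (s := Finset.univ.map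
    (Function.Embedding.subtype fun m : Fin (N + 1) → ℕ => ∑ i, m i = k))]
  · rw [Finset.sum_map]
    refine Finset.sum_congr rfl fun m _ => ?_
    rw [Function.Embedding.subtype_apply, toState_val, toState_val]
  · intro m hm
    rw [Finsupp.mem_support_iff, toState_apply] at hm
    split_ifs at hm with h
    · exact Finset.mem_map.mpr ⟨⟨m, h⟩, Finset.mem_univ _, rfl⟩
    · exact absurd rfl hm
  · simp

theorem conj_slater_weightRoot {N k : ℕ} (s : Weight N k) (l : Fin (N + 1) → ℤ) :
    (starRingEnd ℂ) (slater (weightRoot s) l) = slater (weightRoot s)⁻¹ l := by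
  rw [slater, slater, RingHom.map_det]
  congr 1
  ext i j
  simp only [RingHom.mapMatrix_apply, Matrix.map_apply, Matrix.of_apply, map_zpow₀, Pi.inv_apply]
  congr 1
  rw [weightRoot, ← Complex.exp_conj, ← Complex.exp_neg]
  congr 1
  have hreal : (k : ℂ) + (N + 1) = ((k + (N + 1) : ℝ) : ℂ) := by push_cast; rfl
  rw [hreal]
  simp only [map_mul, map_div₀, Complex.conj_ofReal, Complex.conj_I, Complex.conj_ofNat]
  ring

theorem slater_pos_vac {K : Type*} [Field K] {N : ℕ} {y : Fin (N + 1) → K} (hy : ∏ j, y j = 1)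
    (k : ℕ) : slater y (pos (vac N k).1) = slater y fun i => N - i := by
  rw [← slater_add_const hy (fun i => (N : ℤ) - i) (k : ℤ)]
  have hvac : (vac N k).1 = 0 + Pi.single (Fin.last N) k := (zero_add _).symm
  congr 1
  funext i
  rw [hvac, pos_add_single, if_pos (Fin.le_last i)]
  simp [pos]

/-- The squared norm of the wave of a weight. -/
def waveNorm {N k : ℕ} (s : Weight N k) : ℂ :=
  ∑ m : Weight N k, slater (weightRoot s) (pos m.1) * slater (weightRoot s)⁻¹ (pos m.1)

theorem waveNorm_ne_zero {N k : ℕ} (s : Weight N k) : waveNorm s ≠ 0 := by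
  have hnormSq : waveNorm s =
      ((∑ m : Weight N k, Complex.normSq (slater (weightRoot s) (pos m.1)) : ℝ) : ℂ) := by
    rw [waveNorm, Complex.ofReal_sum]
    refine Finset.sum_congr rfl fun m _ => ?_
    rw [← conj_slater_weightRoot, Complex.mul_conj]
  rw [hnormSq, Complex.ofReal_ne_zero]
  refine (Finset.sum_pos' (fun m _ => Complex.normSq_nonneg _)
    ⟨vac N k, Finset.mem_univ _, ?_⟩).ne'
  rw [Complex.normSq_pos, slater_pos_vac (prod_weightRoot s)]
  exact slater_rev_ne_zero (weightRoot_injective s)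

theorem weightRoot_inv_pow {N k : ℕ} (s : Weight N k) (j : Fin (N + 1)) :
    (weightRoot s)⁻¹ j ^ (k + (N + 1)) = (rootPhase s ^ (k + (N + 1)))⁻¹ := by
  rw [Pi.inv_apply, inv_pow, weightRoot_pow]

theorem sum_slater_mul_slater_inv {N k : ℕ} (s t : Weight N k) :
    ∑ m : Weight N k, slater (weightRoot s) (pos m.1) * slater (weightRoot t)⁻¹ (pos m.1) =
      if s = t then waveNorm s else 0 := by
  split_ifs with h
  · rw [waveNorm, h]
  · by_contra hne
    refine h (eq_of_weightRoot_mem_range (mem_range_of_complete_inv_eq (prod_weightRoot s)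
      (prod_weightRoot t) fun r hr => ?_))
    refine complete_inv_eq_of_sum_ne_zero (z := (weightRoot t)⁻¹) (k := k) (prod_weightRoot s)
      (weightRoot_pow s) (prod_weightRoot t) (weightRoot_pow t) (prod_weightRoot_inv t)
      (weightRoot_inv_pow t) ?_ ?_ (by omega)
    all_goals simp only [wave_apply]
    exacts [hne, waveNorm_ne_zero t]

/-! ## The modular matrix -/

theorem modularS_symm {N k : ℕ} (l s : Weight N k) : modularS N k l s = modularS N k s l := by
  rw [modularS, modularS]
  congr 1
  rw [← Equiv.sum_comp (Equiv.inv (Equiv.Perm (Fin (N + 1))))]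
  refine Finset.sum_congr rfl fun w _ => ?_
  rw [Equiv.inv_apply, Equiv.Perm.sign_inv, inv_inv]
  congr 4
  rw [← Equiv.sum_comp w⁻¹]
  refine Finset.sum_congr rfl fun i _ => ?_
  rw [Equiv.Perm.inv_def, Equiv.apply_symm_apply, mul_comm]

/-- The prefactor `e^{iπn(n-1)/4} (n (k+n)^{n-1})^{-1/2}` of the Kac–Peterson formula. -/
def kacPetersonConst (N k : ℕ) : ℂ := Complex.exp (Complex.I * Real.pi * ((N + 1) * N) / 4) /
  (Real.sqrt (((N : ℝ) + 1) * ((k : ℝ) + (N + 1)) ^ N) : ℂ)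

theorem kacPetersonConst_ne_zero (N k : ℕ) : kacPetersonConst N k ≠ 0 := by
  refine div_ne_zero (Complex.exp_ne_zero _) ?_
  rw [Complex.ofReal_ne_zero, Real.sqrt_ne_zero']
  positivity

theorem modularS_eq {N k : ℕ} (l s : Weight N k) :
    modularS N k l s = kacPetersonConst N k * slater (weightRoot s)⁻¹ (pos l.1) := by
  rw [modularS, ← kacPetersonConst, slater, Matrix.det_apply']
  congr 1
  rw [← Equiv.sum_comp (Equiv.inv (Equiv.Perm (Fin (N + 1))))]
  refine Finset.sum_congr rfl fun w _ => ?_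
  rw [Equiv.inv_apply, Equiv.Perm.sign_inv, inv_inv]
  congr 1
  have hpos : ∑ i, rhoShift s.1 i * rhoShift l.1 (w i) =
      ∑ i, pos l.1 (w i) * rhoShift s.1 i := by
    simp only [rhoShift_eq l.1, mul_comm (rhoShift s.1 _), sub_mul, Finset.sum_sub_distrib,
      ← Finset.mul_sum, sum_rhoShift, mul_zero, sub_zero]
  rw [hpos, Complex.ofReal_sum, Finset.mul_sum, Complex.exp_sum]
  refine Finset.prod_congr rfl fun i _ => ?_
  rw [Matrix.of_apply, Pi.inv_apply, weightRoot, ← Complex.exp_neg, ← Complex.exp_int_mul]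
  congr 1
  push_cast
  ring

/-! ## Particle–hole duality -/

theorem part_antitone {N : ℕ} (m : Fin (N + 1) → ℕ) : Antitone (part m) := by
  intro i j hij
  refine Finset.sum_le_sum_of_subset fun a => ?_
  simp only [Finset.mem_filter, Finset.mem_univ, true_and]
  exact fun h => ⟨hij.trans h.1, h.2⟩

theorem lt_transp_iff {N : ℕ} {m : Fin (N + 1) → ℕ} {i : Fin (N + 1)} {j : ℕ} :
    (i : ℕ) < transp m j ↔ j ≤ part m i := by
  rw [transp]
  constructor
  · contrapose!
    intro h
    rw [← Fin.card_Iio]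
    refine Finset.card_le_card fun a ha => Finset.mem_Iio.mpr ?_
    have haj := (Finset.mem_filter.mp ha).2
    exact (part_antitone m).reflect_lt (h.trans_le haj)
  · intro h
    rw [← Nat.succ_le_iff, Nat.succ_eq_add_one, ← Fin.card_Iic]
    refine Finset.card_le_card fun a ha => Finset.mem_filter.mpr ⟨Finset.mem_univ a, ?_⟩
    exact h.trans (part_antitone m (Finset.mem_Iic.mp ha))

theorem transp_antitone {N : ℕ} (m : Fin (N + 1) → ℕ) : Antitone (transp m) := by
  intro i j hij
  refine Finset.card_le_card fun a => ?_
  simp only [Finset.mem_filter, Finset.mem_univ, true_and]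
  exact fun h => hij.trans h

theorem transp_le {N : ℕ} (m : Fin (N + 1) → ℕ) {j : ℕ} (hj : 0 < j) : transp m j ≤ N := by
  have hlast := lt_transp_iff (m := m) (i := Fin.last N) (j := j)
  rw [part_last, Fin.val_last] at hlast
  omega

/-- The exponents of `ζ` in the roots of `σ` (the particles) and in the inverse Bethe roots of `σ`
(the holes). -/
def particleHole {N k : ℕ} (s : Weight N k) : Fin (N + 1) ⊕ Fin k → ℕ :=
  Sum.elim (fun i => part s.1 i + (N - i)) fun i => N + (k - i) - transp s.1 (k - i)

theorem particleHole_lt {N k : ℕ} (s : Weight N k) (a : Fin (N + 1) ⊕ Fin k) :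
    particleHole s a < k + (N + 1) := by
  rcases a with i | i
  · have := part_le s i
    simp only [particleHole, Sum.elim_inl]
    omega
  · simp only [particleHole, Sum.elim_inr]
    omega

theorem particleHole_injective {N k : ℕ} (s : Weight N k) :
    Function.Injective (particleHole s) := by
  refine Function.Injective.sumElim ?_ ?_ ?_
  · refine StrictAnti.injective fun a b hab => ?_
    have hpart := part_antitone s.1 hab.le
    have : (a : ℕ) < b := hab
    change part s.1 b + (N - b) < part s.1 a + (N - a)
    omega
  · refine StrictAnti.injective fun a b hab => ?_
    have : (a : ℕ) < b := hab
    have htransp := transp_antitone s.1 (show k - (b : ℕ) ≤ k - a by omega)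
    have ha := transp_le s.1 (j := k - a) (by omega)
    change N + (k - b) - transp s.1 (k - b) < N + (k - a) - transp s.1 (k - a)
    omega
  · intro i j h
    have htransp := lt_transp_iff (m := s.1) (i := i) (j := k - j)
    have hle := transp_le s.1 (j := k - j) (by omega)
    omega

theorem neg_inv_betheRoot {N k : ℕ} (s : Weight N k) (i : Fin k) :
    -(betheRoot s i)⁻¹ = zeta N k ^ particleHole s (.inr i) * rootPhase s := by
  have hle := transp_le s.1 (j := k - i) (by omega)
  have hi : (i : ℕ) ≤ k := i.2.le
  rw [betheRoot, ← Complex.exp_neg, neg_eq_neg_one_mul, ← Complex.exp_pi_mul_I, ← Complex.exp_add,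
    zeta, rootPhase, ← Complex.exp_nat_mul, ← Complex.exp_add]
  congr 1
  have hK := level_add_rank_ne_zero N k
  have hn : ((N : ℂ) + 1) ≠ 0 := by exact_mod_cast Nat.succ_ne_zero N
  simp only [particleHole, Sum.elim_inr, rhoConst]
  rw [Nat.cast_sub (by omega), Nat.cast_add, Nat.cast_sub hi]
  push_cast
  field_simp
  ring

theorem prod_one_sub_zeta_pow_particleHole {N k : ℕ} (s : Weight N k) (g : ℂ) :
    ∏ a, (1 - zeta N k ^ particleHole s a * g) = 1 - g ^ (k + (N + 1)) := by
  have hz := isPrimitiveRoot_zeta N k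
  have hpos : 0 < k + (N + 1) := by omega
  have hinj : Function.Injective fun a => zeta N k ^ particleHole s a := fun a b hab =>
    particleHole_injective s (hz.pow_inj (particleHole_lt s a) (particleHole_lt s b) hab)
  have himage : Finset.univ.image (fun a => zeta N k ^ particleHole s a) =
      Polynomial.nthRootsFinset (k + (N + 1)) (1 : ℂ) := by
    refine Finset.eq_of_subset_of_card_le ?_ ?_
    · intro x hx
      obtain ⟨a, -, rfl⟩ := Finset.mem_image.mp hx
      rw [Polynomial.mem_nthRootsFinset hpos, ← pow_mul, mul_comm, pow_mul, hz.pow_eq_one, one_pow]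
    · rw [Finset.card_image_of_injective _ hinj, hz.card_nthRootsFinset]
      simp [add_comm]
  have hfactor := hz.pow_sub_pow_eq_prod_sub_mul 1 g hpos
  rw [one_pow] at hfactor
  rw [hfactor, ← himage, Finset.prod_image fun a _ b _ h => hinj h]

theorem prod_betheRoot_mul_prod_weightRoot {N k : ℕ} (s : Weight N k) :
    (∏ i : Fin k, (1 + PowerSeries.C (betheRoot s i)⁻¹ * PowerSeries.X)) *
      ∏ j, (1 - PowerSeries.C (weightRoot s j) * PowerSeries.X) =
    1 - PowerSeries.C (rootPhase s ^ (k + (N + 1))) * PowerSeries.X ^ (k + (N + 1)) := by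
  have hpoly : (∏ i : Fin k, (1 + Polynomial.C (betheRoot s i)⁻¹ * Polynomial.X)) *
      ∏ j, (1 - Polynomial.C (weightRoot s j) * Polynomial.X) =
      1 - Polynomial.C (rootPhase s ^ (k + (N + 1))) * Polynomial.X ^ (k + (N + 1)) := by
    refine Polynomial.funext fun t => ?_
    have hprod := prod_one_sub_zeta_pow_particleHole s (rootPhase s * t)
    rw [Fintype.prod_sum_type, mul_comm] at hprod
    simp only [Polynomial.eval_mul, Polynomial.eval_prod, Polynomial.eval_add,
      Polynomial.eval_sub, Polynomial.eval_one, Polynomial.eval_C, Polynomial.eval_X,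
      Polynomial.eval_pow]
    rw [← mul_pow, ← hprod]
    congr 1
    · refine Finset.prod_congr rfl fun i _ => ?_
      rw [← mul_assoc, ← neg_inv_betheRoot]
      ring
    · refine Finset.prod_congr rfl fun i _ => ?_
      rw [← mul_assoc, weightRoot_eq]
      rfl
  simpa only [map_mul, map_prod, map_add, map_sub, map_one, map_pow,
    Polynomial.coeToPowerSeries.ringHom_apply, Polynomial.coe_C, Polynomial.coe_X] using
    congrArg Polynomial.coeToPowerSeries.ringHom hpoly

theorem elem_inv_betheRoot {N k : ℕ} (s : Weight N k) {d : ℤ} (hd : d < k + (N + 1)) :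
    elem (List.ofFn fun i : Fin k => (betheRoot s i)⁻¹) d = complete (weightRoot s) d := by
  obtain h | h := lt_or_ge d 0
  · rw [elem, complete, intCoeff_of_neg h, intCoeff_of_neg h]
  lift d to ℕ using h
  have hseries : ∏ i : Fin k, (1 + PowerSeries.C (betheRoot s i)⁻¹ * PowerSeries.X) =
      hSeries (weightRoot s) * (1 -
        PowerSeries.C (rootPhase s ^ (k + (N + 1))) * PowerSeries.X ^ (k + (N + 1))) := by
    rw [← prod_betheRoot_mul_prod_weightRoot, mul_left_comm, mul_comm (hSeries _),
      prod_one_sub_mul_hSeries, mul_one]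
  rw [elem, complete, List.map_ofFn, List.prod_ofFn, intCoeff_natCast]
  simp only [Function.comp_apply]
  rw [hseries, mul_sub, mul_one, map_sub, ← mul_assoc, PowerSeries.coeff_mul_X_pow',
    if_neg (by omega), sub_zero]

-- Particle–hole duality: the Bethe roots are the complementary roots of unity, so the elementary
-- symmetric functions of the one are the complete symmetric functions of the other.
theorem betheVec_eq {N k : ℕ} (hN : 1 ≤ N) (s : Weight N k) :
    betheVec s = (slater (weightRoot s) fun i => N - i)⁻¹ • wave k (weightRoot s) := by
  have hvec := opB_prod_ket_zero hN (List.ofFn fun i : Fin k => (betheRoot s i)⁻¹)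
  rw [List.map_ofFn, List.length_ofFn] at hvec
  rw [betheVec, wave, ← levelVec_smul]
  refine hvec.trans (levelVec_congr fun m => ?_)
  rw [Pi.smul_apply, ← det_complete_mul_slater _ (pos_nonneg m.1), smul_eq_mul,
    mul_comm _ (slater _ _), inv_mul_cancel_left₀ (slater_rev_ne_zero (weightRoot_injective s))]
  congr 2
  funext i j
  refine elem_inv_betheRoot s ?_
  have := pos_le m.1 i
  rw [m.2] at this
  omega

/-! ## The Verlinde formula -/

/-- The character `S_{λσ} / S_{∅σ}` of the Verlinde algebra attached to `σ`, evaluated at `λ`; it is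
also the eigenvalue of `s_λ(𝓐)` on the wave of `σ`. -/
def character {N k : ℕ} (l s : Weight N k) : ℂ := schur (weightRoot s)⁻¹ l.1

theorem slater_inv_weightRoot_rev_ne_zero {N k : ℕ} (s : Weight N k) :
    slater (weightRoot s)⁻¹ (fun i => N - i) ≠ 0 :=
  slater_rev_ne_zero fun _ _ h => weightRoot_injective s (inv_injective h)

theorem character_mul_slater {N k : ℕ} (l s : Weight N k) :
    character l s * slater (weightRoot s)⁻¹ (fun i => N - i) =
      slater (weightRoot s)⁻¹ (pos l.1) :=
  schur_mul_slater (prod_weightRoot_inv s) l.1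

theorem modularS_vac {N k : ℕ} (s : Weight N k) : modularS N k (vac N k) s =
    kacPetersonConst N k * slater (weightRoot s)⁻¹ (fun i => N - i) := by
  rw [modularS_eq, slater_pos_vac (prod_weightRoot_inv s)]

theorem modularS_vac_ne_zero {N k : ℕ} (s : Weight N k) : modularS N k (vac N k) s ≠ 0 := by
  rw [modularS_vac]
  exact mul_ne_zero (kacPetersonConst_ne_zero N k) (slater_inv_weightRoot_rev_ne_zero s)

theorem character_mul_modularS_vac {N k : ℕ} (l s : Weight N k) :
    character l s * modularS N k (vac N k) s = modularS N k l s := by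
  rw [modularS_vac, modularS_eq, ← character_mul_slater]
  ring

theorem character_vac {N k : ℕ} (s : Weight N k) : character (vac N k) s = 1 :=
  (mul_eq_right₀ (modularS_vac_ne_zero s)).mp (character_mul_modularS_vac (vac N k) s)

theorem modularS_mul_slater {N k : ℕ} :
    modularS N k * Matrix.of (fun m s : Weight N k => slater (weightRoot s) (pos m.1) *
      (kacPetersonConst N k * waveNorm s)⁻¹) = 1 := by
  ext t s
  have hterm (m : Weight N k) : modularS N k t m * (slater (weightRoot s) (pos m.1) *
      (kacPetersonConst N k * waveNorm s)⁻¹) =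
      (waveNorm s)⁻¹ * (slater (weightRoot s) (pos m.1) * slater (weightRoot t)⁻¹ (pos m.1)) := by
    have hconst := kacPetersonConst_ne_zero N k
    rw [modularS_symm, modularS_eq]
    field_simp
  simp only [Matrix.mul_apply, Matrix.one_apply, Matrix.of_apply, hterm]
  rw [← Finset.mul_sum, sum_slater_mul_slater_inv]
  by_cases hst : s = t
  · rw [if_pos hst, if_pos hst.symm, inv_mul_cancel₀ (waveNorm_ne_zero s)]
  · rw [if_neg hst, if_neg (Ne.symm hst), mul_zero]

theorem modularS_inv_apply {N k : ℕ} (v s : Weight N k) : (modularS N k)⁻¹ v s =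
    slater (weightRoot s) (pos v.1) * (kacPetersonConst N k * waveNorm s)⁻¹ := by
  rw [Matrix.inv_eq_right_inv modularS_mul_slater]
  rfl

theorem modularS_mul_inv (N k : ℕ) : modularS N k * (modularS N k)⁻¹ = 1 := by
  rw [Matrix.inv_eq_right_inv modularS_mul_slater, modularS_mul_slater]

theorem sum_smul_wave {N k : ℕ} {ι : Type*} [Fintype ι] (a : ι → ℂ) (y : ι → Fin (N + 1) → ℂ) :
    ∑ s, a s • wave k (y s) =
      toState fun m : Weight N k => ∑ s, a s * slater (y s) (pos m.1) := by
  simp only [wave, levelVec, toState, Finset.smul_sum, Finset.sum_smul, smul_smul]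
  exact Finset.sum_comm

theorem toState_single {N k : ℕ} (m : Weight N k) : toState (Pi.single m 1) = ket m.1 := by
  simp [toState, Pi.single_apply]

theorem ket_eq_sum_wave {N k : ℕ} (m : Weight N k) :
    ket m.1 = ∑ s : Weight N k,
      (modularS N k s m * (kacPetersonConst N k * waveNorm s)⁻¹) • wave k (weightRoot s) := by
  rw [sum_smul_wave, ← toState_single]
  refine congrArg toState (funext fun v => ?_)
  have hinv : (modularS N k)⁻¹ * modularS N k = 1 := mul_eq_one_comm.mp (modularS_mul_inv N k)
  rw [Pi.single_apply, ← Matrix.one_apply, ← hinv, Matrix.mul_apply]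
  refine Finset.sum_congr rfl fun s _ => ?_
  rw [modularS_inv_apply]
  ring

theorem fusionCoeff_eq {N k : ℕ} (l m v : Weight N k) : fusionCoeff N k l m v =
    ∑ s, character l s * modularS N k m s * (modularS N k)⁻¹ v s := by
  refine Finset.sum_congr rfl fun s _ => ?_
  have hvac := modularS_vac_ne_zero s
  rw [← character_mul_modularS_vac l]
  field_simp

theorem schurOp_ket {N k : ℕ} (l m : Weight N k) :
    schurOp 1 l.toPart (ket m.1) = toState (fusionCoeff N k l m) := by
  rw [ket_eq_sum_wave m, map_sum]
  simp only [map_smul, schurOp_wave (prod_weightRoot _) (weightRoot_pow _), smul_smul,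
    sum_smul_wave]
  refine congrArg toState (funext fun v => ?_)
  rw [fusionCoeff_eq]
  refine Finset.sum_congr rfl fun s _ => ?_
  rw [modularS_inv_apply, modularS_symm s m, character]
  ring

theorem combConst_eq_fusionCoeff {N k : ℕ} (l m v : Weight N k) :
    combConst N k 1 l m v = fusionCoeff N k l m v := by
  rw [combConst, schurOp_ket, toState_val]

theorem sum_fusionCoeff_mul_character {N k : ℕ} (l m s : Weight N k) :
    ∑ v, fusionCoeff N k l m v * character v s = character l s * character m s := by
  have hinv (t : Weight N k) :
      ∑ v, (modularS N k)⁻¹ v t * modularS N k v s = if s = t then 1 else 0 := by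
    rw [← Matrix.one_apply, ← modularS_mul_inv, Matrix.mul_apply]
    exact Finset.sum_congr rfl fun v _ => by rw [modularS_symm s v, mul_comm]
  refine mul_right_cancel₀ (modularS_vac_ne_zero s) ?_
  calc (∑ v, fusionCoeff N k l m v * character v s) * modularS N k (vac N k) s
      = ∑ v, fusionCoeff N k l m v * modularS N k v s := by
        simp only [Finset.sum_mul, mul_assoc, character_mul_modularS_vac]
    _ = ∑ t, character l t * modularS N k m t *
          ∑ v, (modularS N k)⁻¹ v t * modularS N k v s := by
        simp only [fusionCoeff_eq, Finset.sum_mul, Finset.mul_sum, mul_assoc]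
        exact Finset.sum_comm
    _ = character l s * modularS N k m s := by
        simp only [hinv, mul_ite, mul_one, mul_zero, Finset.sum_ite_eq, Finset.mem_univ, if_true]
    _ = character l s * character m s * modularS N k (vac N k) s := by
        rw [mul_assoc, character_mul_modularS_vac]

/-- The joint evaluation of all characters `λ̂ ↦ (χ_λ(σ))_σ`, which turns the combinatorial product
into the pointwise one. -/
def characterMap (N k : ℕ) : (Weight N k → ℂ) →ₗ[ℂ] (Weight N k → ℂ) :=
  (Matrix.of fun l s : Weight N k => character l s).vecMulLinear

theorem characterMap_apply {N k : ℕ} (f : Weight N k → ℂ) (s : Weight N k) :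
    characterMap N k f s = ∑ l, f l * character l s := rfl

theorem characterMap_injective (N k : ℕ) : Function.Injective (characterMap N k) := by
  rw [← LinearMap.ker_eq_bot, LinearMap.ker_eq_bot']
  intro f hf
  have hvecMul : Matrix.vecMul f (modularS N k) = 0 := by
    funext s
    calc Matrix.vecMul f (modularS N k) s
        = characterMap N k f s * modularS N k (vac N k) s := by
          simp only [characterMap_apply, Finset.sum_mul, mul_assoc, character_mul_modularS_vac]
          rfl
      _ = 0 := by rw [hf, Pi.zero_apply, zero_mul]
  rw [← Matrix.vecMul_one f, ← modularS_mul_inv, ← Matrix.vecMul_vecMul, hvecMul,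
    Matrix.zero_vecMul]

theorem characterMap_bijective (N k : ℕ) : Function.Bijective (characterMap N k) :=
  ⟨characterMap_injective N k, LinearMap.injective_iff_surjective.mp (characterMap_injective N k)⟩

theorem characterMap_strMul {N k : ℕ} (f g : Weight N k → ℂ) :
    characterMap N k (strMul (combConst N k 1) f g) = characterMap N k f * characterMap N k g := by
  funext s
  rw [Pi.mul_apply, characterMap_apply, characterMap_apply, characterMap_apply, Finset.sum_mul_sum]
  simp only [strMul, Finset.sum_mul, combConst_eq_fusionCoeff]
  rw [Finset.sum_comm]
  refine Finset.sum_congr rfl fun l _ => ?_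
  rw [Finset.sum_comm]
  refine Finset.sum_congr rfl fun m _ => ?_
  simp only [mul_assoc]
  rw [← Finset.mul_sum, ← Finset.mul_sum, sum_fusionCoeff_mul_character]
  ring

theorem characterMap_single_vac (N k : ℕ) : characterMap N k (Pi.single (vac N k) 1) = 1 := by
  funext s
  simp [characterMap_apply, Pi.single_apply, character_vac]

theorem isCommAlg_combConst (N k : ℕ) :
    IsCommAlg (combConst N k 1) (Pi.single (vac N k) 1) where
  comm f g := characterMap_injective N k (by simp only [characterMap_strMul, mul_comm])
  assoc f g h := characterMap_injective N k (by simp only [characterMap_strMul, mul_assoc])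
  unit f := characterMap_injective N k (by
    rw [characterMap_strMul, characterMap_single_vac, one_mul])

theorem isSemisimpleRing_strAlg {N k : ℕ}
    (h : IsCommAlg (combConst N k 1) (Pi.single (vac N k) 1)) : IsSemisimpleRing (StrAlg h) := by
  let eval : StrAlg h →+* (Weight N k → ℂ) :=
    { toFun := characterMap N k
      map_one' := characterMap_single_vac N k
      map_mul' := characterMap_strMul
      map_zero' := map_zero (characterMap N k)
      map_add' := map_add (characterMap N k) }
  have evalEquiv : StrAlg h ≃+* (Weight N k → ℂ) :=
    RingEquiv.ofBijective eval (characterMap_bijective N k)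
  exact evalEquiv.symm.isSemisimpleRing

theorem strMul_single {R ι : Type} [CommRing R] [Fintype ι] [DecidableEq ι] (c : ι → ι → ι → R)
    (i j : ι) : strMul c (Pi.single i 1) (Pi.single j 1) = c i j := by
  funext l
  simp [strMul, Pi.single_apply]

theorem toState_strMul_single {N k : ℕ} (l m : Weight N k) :
    toState (strMul (combConst N k 1) (Pi.single l 1) (Pi.single m 1)) =
      schurOp 1 l.toPart (ket m.1) := by
  rw [strMul_single, schurOp_ket]
  exact congrArg toState (funext fun v => combConst_eq_fusionCoeff l m v)

/-! ## Integrality and extension of scalars -/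

/-- The operators that preserve the lattice of states with integral coordinates. -/
def integralOps (N : ℕ) : Subring (Module.End ℂ (State N)) where
  carrier := {X | ∀ f : State N, (∀ m, ∃ a : ℤ, f m = a) → ∀ m, ∃ a : ℤ, X f m = a}
  mul_mem' {X Y} hX hY f hf := hX _ (hY _ hf)
  one_mem' _ hf := hf
  add_mem' {X Y} hX hY f hf m := by
    obtain ⟨a, ha⟩ := hX f hf m
    obtain ⟨b, hb⟩ := hY f hf m
    exact ⟨a + b, by rw [LinearMap.add_apply, Finsupp.add_apply, ha, hb, Int.cast_add]⟩
  zero_mem' _ _ _ := ⟨0, Int.cast_zero.symm⟩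
  neg_mem' {X} hX f hf m := by
    obtain ⟨a, ha⟩ := hX f hf m
    exact ⟨-a, by rw [LinearMap.neg_apply, Finsupp.neg_apply, ha, Int.cast_neg]⟩

theorem create_mem_integralOps {N : ℕ} (i : Fin (N + 1)) : create i ∈ integralOps N := by
  intro f hf m
  rw [create_apply]
  split_ifs
  · exact hf _
  · exact ⟨0, Int.cast_zero.symm⟩

theorem annih_mem_integralOps {N : ℕ} (i : Fin (N + 1)) : annih i ∈ integralOps N := by
  intro f hf m
  rw [annih_apply]
  exact hf _

theorem hOp_mem_integralOps (N r : ℕ) : hOp 1 r ∈ integralOps N := by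
  refine Subring.sum_mem _ fun ε _ => ?_
  rw [one_pow, one_smul]
  refine Subring.mul_mem _ (Subring.mul_mem _ (Subring.pow_mem _ (create_mem_integralOps _) _)
    (Subring.list_prod_mem _ fun X hX => ?_)) (Subring.pow_mem _ (annih_mem_integralOps _) _)
  obtain ⟨j, rfl⟩ := (List.mem_ofFn' _ _).mp hX
  exact Subring.pow_mem _ (Subring.mul_mem _ (create_mem_integralOps _)
    (annih_mem_integralOps _)) _

theorem schurOp_mem_integralOps {N : ℕ} (l : Fin N → ℕ) : schurOp 1 l ∈ integralOps N := by
  refine Subring.sum_mem _ fun w _ => Subring.zsmul_mem _ (Subring.list_prod_mem _ fun X hX => ?_) _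
  obtain ⟨j, rfl⟩ := (List.mem_ofFn' _ _).mp hX
  simp only [hOpInt]
  split_ifs
  · exact hOp_mem_integralOps N _
  · exact Subring.zero_mem _

theorem exists_int_fusionCoeff {N k : ℕ} (l m v : Weight N k) :
    ∃ a : ℤ, (a : ℂ) = fusionCoeff N k l m v := by
  have hket (m' : Fin (N + 1) → ℕ) : ∃ a : ℤ, ket m.1 m' = a :=
    ⟨if m.1 = m' then 1 else 0, by rw [ket_apply, Int.cast_ite, Int.cast_one, Int.cast_zero]⟩
  obtain ⟨a, ha⟩ := schurOp_mem_integralOps l.toPart (ket m.1) hket v.1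
  exact ⟨a, by rw [← ha, ← combConst_eq_fusionCoeff, combConst]⟩

theorem strMul_intCast {ι : Type} [Fintype ι] (c : ι → ι → ι → ℤ) (f g : ι → ℤ) :
    strMul (fun i j l => (c i j l : ℂ)) (fun i => (f i : ℂ)) (fun i => (g i : ℂ)) =
      fun l => ((strMul c f g l : ℤ) : ℂ) := by
  funext l
  simp [strMul]

theorem intCast_comp_injective {ι : Type} :
    Function.Injective fun (f : ι → ℤ) (i : ι) => (f i : ℂ) :=
  fun _ _ h => funext fun i => Int.cast_injective (congrFun h i)

theorem isCommAlg_of_intCast {ι : Type} [Fintype ι] {c : ι → ι → ι → ℤ} {e : ι → ℤ}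
    (h : IsCommAlg (fun i j l => (c i j l : ℂ)) fun i => (e i : ℂ)) : IsCommAlg c e where
  comm f g := intCast_comp_injective (by simp only [← strMul_intCast]; exact h.comm _ _)
  assoc f g k := intCast_comp_injective (by simp only [← strMul_intCast]; exact h.assoc _ _ _)
  unit f := intCast_comp_injective (by simp only [← strMul_intCast]; exact h.unit _)

theorem intCast_single {ι : Type} [DecidableEq ι] (i : ι) :
    (fun j => ((Pi.single i 1 : ι → ℤ) j : ℂ)) = Pi.single i 1 := by
  funext j
  rw [Pi.single_apply, Pi.single_apply, Int.cast_ite, Int.cast_one, Int.cast_zero]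

/-- The standard basis of an algebra over `ℤ` given by structure constants. -/
def StrAlg.basisInt {ι : Type} [Fintype ι] {c : ι → ι → ι → ℤ} {e : ι → ℤ}
    (h : IsCommAlg c e) : Module.Basis ι ℤ (StrAlg h) :=
  Module.Basis.ofEquivFun (AddEquiv.toIntLinearEquiv
    ({ (Equiv.refl (ι → ℤ)) with map_add' := fun _ _ => rfl } : StrAlg h ≃+ (ι → ℤ)))

theorem StrAlg.basisInt_apply {ι : Type} [Fintype ι] [DecidableEq ι] {c : ι → ι → ι → ℤ}
    {e : ι → ℤ} (h : IsCommAlg c e) (i : ι) :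
    StrAlg.basisInt h i = StrAlg.of h (Pi.single i 1) := by
  rw [basisInt, Module.Basis.coe_ofEquivFun]
  rfl

/-- The standard basis of an algebra over `ℂ` given by structure constants. -/
def StrAlg.basisComplex {ι : Type} [Fintype ι] {c : ι → ι → ι → ℂ} {e : ι → ℂ}
    (h : IsCommAlg c e) : Module.Basis ι ℂ (StrAlg h) :=
  Module.Basis.ofEquivFun
    ({ (Equiv.refl (ι → ℂ)) with
        map_add' := fun _ _ => rfl
        map_smul' := fun _ _ => rfl } : StrAlg h ≃ₗ[ℂ] (ι → ℂ))

theorem StrAlg.basisComplex_apply {ι : Type} [Fintype ι] [DecidableEq ι] {c : ι → ι → ι → ℂ}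
    {e : ι → ℂ} (h : IsCommAlg c e) (i : ι) :
    StrAlg.basisComplex h i = StrAlg.of h (Pi.single i 1) := by
  rw [basisComplex, Module.Basis.coe_ofEquivFun]
  rfl

/-- The inclusion of an integral form, for structure constants over `ℂ` that are integers. -/
def StrAlg.intCastHom {ι : Type} [Fintype ι] {c : ι → ι → ι → ℤ} {e : ι → ℤ}
    {C : ι → ι → ι → ℂ} {E : ι → ℂ} (h : IsCommAlg c e) (H : IsCommAlg C E)
    (hc : ∀ i j l, (c i j l : ℂ) = C i j l) (he : ∀ i, (e i : ℂ) = E i) :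
    StrAlg h →+* StrAlg H where
  toFun f := StrAlg.of H fun i => ((f : ι → ℤ) i : ℂ)
  map_one' := funext he
  map_mul' f g := by
    obtain rfl : (fun i j l => (c i j l : ℂ)) = C :=
      funext fun i => funext fun j => funext (hc i j)
    exact (strMul_intCast c f g).symm
  map_zero' := funext fun _ => Int.cast_zero
  map_add' _ _ := funext fun _ => Int.cast_add _ _

theorem StrAlg.exists_algEquiv {ι : Type} [Fintype ι] [DecidableEq ι] {c : ι → ι → ι → ℤ}
    {e : ι → ℤ} {C : ι → ι → ι → ℂ} {E : ι → ℂ} (h : IsCommAlg c e) (H : IsCommAlg C E)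
    (hc : ∀ i j l, (c i j l : ℂ) = C i j l) (he : ∀ i, (e i : ℂ) = E i) :
    ∃ Φ : StrAlg H ≃ₐ[ℂ] ℂ ⊗[ℤ] StrAlg h,
      ∀ l, Φ (StrAlg.of H (Pi.single l 1)) = 1 ⊗ₜ[ℤ] StrAlg.of h (Pi.single l 1) := by
  let F : ℂ ⊗[ℤ] StrAlg h →ₐ[ℂ] StrAlg H := Algebra.TensorProduct.lift
    (Algebra.ofId ℂ (StrAlg H)) (StrAlg.intCastHom h H hc he).toIntAlgHom
    (fun _ _ => Commute.all _ _)
  have F_single (l : ι) : F (1 ⊗ₜ[ℤ] StrAlg.of h (Pi.single l 1)) =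
      StrAlg.of H (Pi.single l 1) := by
    rw [Algebra.TensorProduct.lift_tmul, map_one, one_mul]
    exact intCast_single l
  let basisEquiv := (Algebra.TensorProduct.basis ℂ (StrAlg.basisInt h)).equiv
    (StrAlg.basisComplex H) (Equiv.refl ι)
  have hF : F.toLinearMap = basisEquiv.toLinearMap := by
    refine (Algebra.TensorProduct.basis ℂ (StrAlg.basisInt h)).ext fun l => ?_
    rw [LinearEquiv.coe_coe, Module.Basis.equiv_apply, Algebra.TensorProduct.basis_apply,
      StrAlg.basisInt_apply, StrAlg.basisComplex_apply]
    exact F_single l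
  have hbij : Function.Bijective F := by
    have hcoe : (F : ℂ ⊗[ℤ] StrAlg h → StrAlg H) = basisEquiv := congrArg DFunLike.coe hF
    rw [hcoe]
    exact basisEquiv.bijective
  refine ⟨(AlgEquiv.ofBijective F hbij).symm, fun l => ?_⟩
  rw [AlgEquiv.symm_apply_eq]
  exact (F_single l).symm

/-! ## Bethe vectors -/

theorem betheVec_eq_toState {N k : ℕ} (hN : 1 ≤ N) (s : Weight N k) :
    betheVec s = toState fun m : Weight N k =>
      (slater (weightRoot s) fun i => N - i)⁻¹ * slater (weightRoot s) (pos m.1) := by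
  rw [betheVec_eq hN, wave, ← levelVec_smul]
  rfl

theorem inn_betheVec {N k : ℕ} (hN : 1 ≤ N) (s : Weight N k) :
    inn (betheVec s) (betheVec s) = (slater (weightRoot s)⁻¹ fun i => N - i)⁻¹ *
      (slater (weightRoot s) fun i => N - i)⁻¹ * waveNorm s := by
  rw [betheVec_eq_toState hN, inn_toState, waveNorm, Finset.mul_sum]
  refine Finset.sum_congr rfl fun m _ => ?_
  rw [map_mul, map_inv₀, conj_slater_weightRoot, conj_slater_weightRoot]
  ring

theorem characterMap_slater {N k : ℕ} (s : Weight N k) :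
    characterMap N k (fun m => slater (weightRoot s) (pos m.1)) =
      Pi.single s ((slater (weightRoot s)⁻¹ fun i => N - i)⁻¹ * waveNorm s) := by
  funext t
  have hchar (m : Weight N k) : character m t =
      slater (weightRoot t)⁻¹ (pos m.1) * (slater (weightRoot t)⁻¹ fun i => N - i)⁻¹ := by
    rw [← character_mul_slater, mul_inv_cancel_right₀ (slater_inv_weightRoot_rev_ne_zero t)]
  simp only [characterMap_apply, hchar, ← mul_assoc]
  rw [← Finset.sum_mul, sum_slater_mul_slater_inv, Pi.single_apply]
  by_cases hst : s = t
  · rw [if_pos hst, if_pos hst.symm, hst, mul_comm]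
  · rw [if_neg hst, if_neg (Ne.symm hst), zero_mul]

theorem characterMap_betheHat {N k : ℕ} (hN : 1 ≤ N) (s : Weight N k) :
    characterMap N k (betheHat s) = Pi.single s 1 := by
  have hrev := slater_rev_ne_zero (weightRoot_injective s)
  have hrev_inv := slater_inv_weightRoot_rev_ne_zero s
  have hnorm := waveNorm_ne_zero s
  have hbethe : betheHat s = ((slater (weightRoot s) fun i => N - i)⁻¹ /
      inn (betheVec s) (betheVec s)) • fun m => slater (weightRoot s) (pos m.1) := by
    funext m
    rw [betheHat, congrArg (fun f : State N => f m.1) (betheVec_eq_toState hN s), toState_val,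
      Pi.smul_apply, smul_eq_mul]
    ring
  rw [hbethe, map_smul, characterMap_slater, inn_betheVec hN, ← Pi.single_smul, smul_eq_mul]
  congr 1
  field_simp

theorem strMul_betheHat {N k : ℕ} (hN : 1 ≤ N) (s t : Weight N k) :
    strMul (combConst N k 1) (betheHat s) (betheHat t) = if s = t then betheHat s else 0 := by
  apply characterMap_injective N k
  rw [characterMap_strMul, characterMap_betheHat hN, characterMap_betheHat hN,
    apply_ite (characterMap N k), characterMap_betheHat hN, map_zero]
  funext u
  simp only [Pi.mul_apply, Pi.single_apply]
  split_ifs <;> simp_all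

theorem toState_mem_levelSpace {N k : ℕ} (f : Weight N k → ℂ) : toState f ∈ levelSpace N k := by
  refine Submodule.sum_mem _ fun m _ => Submodule.smul_mem _ _ ?_
  exact Finsupp.single_mem_supported ℂ 1 m.2

theorem span_betheVec {N k : ℕ} (hN : 1 ≤ N) :
    Submodule.span ℂ (Set.range fun s : Weight N k => betheVec s) = levelSpace N k := by
  apply le_antisymm
  · rw [Submodule.span_le]
    rintro _ ⟨s, rfl⟩
    simp only [betheVec_eq_toState hN]
    exact toState_mem_levelSpace _
  · rw [levelSpace, Finsupp.supported_eq_span_single, Submodule.span_le]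
    rintro _ ⟨m, hm, rfl⟩
    change ket (⟨m, hm⟩ : Weight N k).1 ∈ _
    rw [ket_eq_sum_wave]
    refine Submodule.sum_mem _ fun s _ => Submodule.smul_mem _ _ ?_
    have hwave : wave k (weightRoot s) =
        (slater (weightRoot s) fun i => N - i) • betheVec s := by
      rw [betheVec_eq hN, smul_inv_smul₀ (slater_rev_ne_zero (weightRoot_injective s))]
    rw [hwave]
    exact Submodule.smul_mem _ _ (Submodule.subset_span ⟨s, rfl⟩)

theorem finrank_levelSpace (N k : ℕ) :
    Module.finrank ℂ (levelSpace N k) = Fintype.card (Weight N k) := by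
  rw [levelSpace, (Finsupp.supportedEquivFinsupp _).finrank_eq]
  exact Module.finrank_finsupp_self ℂ (ι := Weight N k)

theorem linearIndependent_betheVec {N k : ℕ} (hN : 1 ≤ N) :
    LinearIndependent ℂ (fun s : Weight N k => betheVec s) := by
  rw [linearIndependent_iff_card_eq_finrank_span, Set.finrank, span_betheVec hN,
    finrank_levelSpace]

theorem exists_hOp_betheVec {N k : ℕ} (hN : 1 ≤ N) (s : Weight N k) (r : ℕ) :
    ∃ a : ℂ, hOp 1 r (betheVec s) = a • betheVec s := by
  obtain ⟨a, ha⟩ := exists_hOp_wave (prod_weightRoot s) (weightRoot_pow s) r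
  exact ⟨a, by rw [betheVec_eq hN, map_smul, ha, smul_comm]⟩

theorem opT_betheVec {N k : ℕ} (hN : 1 ≤ N) (s : Weight N k) (u : ℂ) :
    opT 1 u (betheVec s) = (∏ j, (1 + u * (weightRoot s j)⁻¹)) • betheVec s := by
  rw [betheVec_eq hN, map_smul, opT_wave hN (prod_weightRoot s) (weightRoot_pow s), smul_comm]

theorem betheComplete {N : ℕ} (hN : 1 ≤ N) (k : ℕ) : BetheComplete N k :=
  ⟨linearIndependent_betheVec hN, span_betheVec hN, fun s =>
    ⟨exists_hOp_betheVec hN s, fun u => ⟨_, opT_betheVec hN s u⟩⟩⟩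

theorem hOp_comm {N k : ℕ} (hN : 1 ≤ N) (r s : ℕ) {f : State N} (hf : f ∈ levelSpace N k) :
    hOp 1 r (hOp 1 s f) = hOp 1 s (hOp 1 r f) := by
  have heqOn : Set.EqOn (hOp 1 r * hOp 1 s : Module.End ℂ (State N))
      (hOp 1 s * hOp 1 r : Module.End ℂ (State N))
      (Submodule.span ℂ (Set.range fun t : Weight N k => betheVec t)) := by
    refine LinearMap.eqOn_span' ?_
    rintro _ ⟨t, rfl⟩
    obtain ⟨a, ha⟩ := exists_hOp_betheVec hN t r
    obtain ⟨b, hb⟩ := exists_hOp_betheVec hN t s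
    simp only [Module.End.mul_apply, ha, hb, map_smul, smul_smul, mul_comm]
  rw [span_betheVec hN] at heqOn
  exact heqOn hf

end

end PhaseModel

theorem mainTheorem6 (N k : ℕ) (hN : 1 ≤ N) :
    -- the entries of the determinants `s_λ(𝓐)` commute on `ℂP_k⁺`
    (∀ (r s : ℕ), ∀ f ∈ PhaseModel.levelSpace N k,
      PhaseModel.hOp 1 r (PhaseModel.hOp 1 s f) = PhaseModel.hOp 1 s (PhaseModel.hOp 1 r f)) ∧
    -- `λ̂ * μ̂ = s_λ(𝓐) μ̂` is a product on `ℂP_k⁺`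
    (∀ l m : PhaseModel.Weight N k,
      PhaseModel.toState (PhaseModel.strMul (PhaseModel.combConst N k 1)
        (Pi.single l 1) (Pi.single m 1)) =
      PhaseModel.schurOp 1 l.toPart (PhaseModel.ket m.1)) ∧
    -- it is associative and commutative with unit `∅̂`
    ∃ hc : PhaseModel.IsCommAlg (PhaseModel.combConst N k 1) (Pi.single (PhaseModel.vac N k) 1),
    -- the fusion ring over `ℤ`, with the structure constants of the Verlinde formula
    ∃ c : PhaseModel.Weight N k → PhaseModel.Weight N k → PhaseModel.Weight N k → ℤ,
    (∀ l m v, (c l m v : ℂ) = PhaseModel.fusionCoeff N k l m v) ∧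
    ∃ hv : PhaseModel.IsCommAlg c (Pi.single (PhaseModel.vac N k) 1),
    -- isomorphism with the Verlinde algebra
    (∃ Φ : PhaseModel.StrAlg hc ≃ₐ[ℂ] ℂ ⊗[ℤ] PhaseModel.StrAlg hv,
      ∀ l, Φ (PhaseModel.StrAlg.of hc (Pi.single l 1)) =
        1 ⊗ₜ[ℤ] PhaseModel.StrAlg.of hv (Pi.single l 1)) ∧
    -- the normalised Bethe vectors are orthogonal idempotents
    (∀ s t : PhaseModel.Weight N k,
      PhaseModel.strMul (PhaseModel.combConst N k 1)
        (PhaseModel.betheHat s) (PhaseModel.betheHat t) =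
      if s = t then PhaseModel.betheHat s else 0) ∧
    -- completeness of the Bethe ansatz and semisimplicity are equivalent, and both hold
    (PhaseModel.BetheComplete N k ↔ IsSemisimpleRing (ℂ ⊗[ℤ] PhaseModel.StrAlg hv)) ∧
    PhaseModel.BetheComplete N k := by
  open PhaseModel in
  have hc := isCommAlg_combConst N k
  choose c hcF using fun l m v : Weight N k => exists_int_fusionCoeff l m v
  have hcC (l m v : Weight N k) : (c l m v : ℂ) = combConst N k 1 l m v := by
    rw [hcF, combConst_eq_fusionCoeff]
  have hv : IsCommAlg c (Pi.single (vac N k) 1) := by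
    apply isCommAlg_of_intCast
    simpa only [intCast_single, hcC] using hc
  obtain ⟨Φ, hΦ⟩ := StrAlg.exists_algEquiv hv hc hcC (congrFun (intCast_single (vac N k)))
  have hsemisimple : IsSemisimpleRing (ℂ ⊗[ℤ] StrAlg hv) :=
    have := isSemisimpleRing_strAlg hc
    Φ.toRingEquiv.isSemisimpleRing
  exact ⟨fun r s _ hf => hOp_comm hN r s hf, toState_strMul_single, hc, c, hcF, hv, ⟨Φ, hΦ⟩,
    strMul_betheHat hN, iff_of_true (betheComplete hN k) hsemisimple, betheComplete hN k⟩
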